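/- **Setting.** Let $\mathbb{R}_+^{\mathbb{Z}}$ be the space of double-sided sequences of nonnegative reals with the metric $$d(\mathbf{x},\mathbf{y})=\sum_{i\in\mathbb{Z}}\frac{|x_i-y_i|\wedge 1}{2^{|i|+1}},$$ with pointwise multiplication by positive numbers, let $\mathbf{e}_i$ be the sequence whose $i$-th component is $1$ and whose other components are $0$, and for $j\ge 0$ let $\mathbb{C}_{\le j}$ be the set of sequences with at most $j$ positive components. For a closed set $C\subset\mathbb{R}_+^{\mathbb{Z}}$, $\mathbb{M}(\mathbb{R}_+^{\mathbb{Z}}\setminus C)$ is the set of Borel measures on $\mathbb{R}_+^{\mathbb{Z}}\setminus C$ that are finite on $\{\mathbf{x}: d(\mathbf{x},C)\ge r\}$ for every $r>0$, with the coarsest topology that makes $\mu\mapsto\int f\,d\mu$ continuous for every nonnegative bounded continuous $f$ on $\mathbb{R}_+^{\mathbb{Z}}\setminus C$ that vanishes on $\{\mathbf{x}: d(\mathbf{x},C)<r\}$ for some $r>0$. Measures on $\mathbb{R}_+^{\mathbb{Z}}$ are regarded as measures on $\mathbb{R}_+^{\mathbb{Z}}\setminus C$ by restriction. Let $\alpha>0$,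 let $\mathbf{Z}=(Z_i)_{i\in\mathbb{Z}}$ be i.i.d. random variables in $\mathbb{R}_+=[0,\infty)$, and let $b:(0,\infty)\to(0,\infty)$ satisfy $$\lim_{t\to\infty}t\,P[Z_0>b(t)z]=z^{-\alpha}\quad\text{for all } z>0 .$$ Let $\nu_\alpha$ be the measure on $(0,\infty)$ with $\nu_\alpha(x,\infty)=x^{-\alpha}$ for $x>0$. For $j\ge0$ and $t>0$ put $$\mu^{(j)}_t(\cdot)=t\,P\big[\mathbf{Z}/b(t^{1/(j+1)})\in\cdot\big],\qquad \mu^{(j)}(\cdot)=\sum_{i_1<\dots<i_{j+1}}\int \mathbb{1}\Big\{\sum_{k=1}^{j+1}z_k\mathbf{e}_{i_k}\in\cdot\Big\}\,\nu_\alpha(dz_1)\cdots\nu_\alpha(dz_{j+1}),$$ where the sum is over all integers $i_1<\dots<i_{j+1}$. Let $(\psi_l)_{l\ge 0}$ be nonnegative constants with $\psi_0>0$, and for $m\ge0$ define $$\big(\mathbf{T}^m(\mathbf{z})\big)_k=\sum_{l=0}^m\psi_l z_{k-l},\qquad X^m_k=\sum_{l=0}^m\psi_l Z_{k-l}\qquad(k\in\mathbb{Z}),\qquad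 \mathbf{X}^m=(X^m_k)_{k\in\mathbb{Z}}=\mathbf{T}^m(\mathbf{Z}).$$ **Theorem.** For every $m\ge0$ and $j\ge0$: 1. $\mathbf{T}^m(\mathbb{C}_{\le j})$ is closed and is a cone (invariant under multiplication by every $c>0$), $\mathbf{T}^m(\mathbb{C}_{\le j})\subset\mathbf{T}^m(\mathbb{C}_{\le j+1})$, and $b(t^{1/(j+1)})/b(t^{1/(j+2)})\to\infty$ as $t\to\infty$. 2. The measures $\mu_t^{(j)}\circ(\mathbf{T}^m)^{-1}$ $(t>0)$ and $\mu^{(j)}\circ(\mathbf{T}^m)^{-1}$ belong to $\mathbb{M}(\mathbb{R}_+^{\mathbb{Z}}\setminus\mathbf{T}^m(\mathbb{C}_{\le j}))$, and there, as $t\to\infty$, $$\mu_t^{(j)}\circ(\mathbf{T}^m)^{-1}\;\longrightarrow\;\mu^{(j)}\circ(\mathbf{T}^m)^{-1};$$ equivalently (the measures on the two sides being the same as before), $$t\,P\big[\mathbf{X}^m/b(t^{1/(j+1)})\in\cdot\big]\;\longrightarrow\;\sum_{i_1<\dots<i_{j+1}}\int \mathbb{1}\Big\{\mathbf{T}^m\Big(\sum_{k=1}^{j+1}z_k\mathbf{e}_{i_k}\Big)\in\cdot\Big\}\,\nu_\alpha(dz_1)\cdots\nu_\alpha(dz_{j+1}).$$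 3. The limit measure on $\mathbb{R}_+^{\mathbb{Z}}\setminus\mathbf{T}^m(\mathbb{C}_{\le j})$ is nonzero and concentrated on $\mathbf{T}^m(\mathbb{C}_{\le j+1})\setminus\mathbf{T}^m(\mathbb{C}_{\le j})$. So, as $j$ runs through $0,1,2,\dots$, $\mathbf{X}^m$ has a nested infinite family of (hidden) regular variation properties, on smaller and smaller spaces and with finer and finer scalings $b(t^{1/(j+1)})$. -/

import Mathlib

open MeasureTheory ProbabilityTheory Filter Topology Set
open scoped NNReal ENNReal BoundedContinuousFunction

/-! ### The spaces `M(S \ C)` -/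

/-- The class of Borel measures on `S \ C` whose restriction to `S \ C^r` is finite for each
`r > 0`, where `C^r = {x | d(x, C) < r}` is `Metric.thickening r C`. -/
def MO {S : Type*} [PseudoMetricSpace S] [MeasurableSpace S] (C : Set S) : Type _ :=
  {μ : Measure (Cᶜ : Set S) //
    ∀ r : ℝ, 0 < r → μ {x | (x : S) ∉ Metric.thickening r C} < ∞}

/-- The underlying measure on `S \ C` of an element of `M(S \ C)`. -/
def MO.toMeasure {S : Type*} [PseudoMetricSpace S] [MeasurableSpace S] {C : Set S} (μ : MO C) :
    Measure (Cᶜ : Set S) := μ.1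

/-- The test functions: nonnegative bounded continuous functions on `S \ C` that vanish on `C^r`
for some `r > 0`. -/
def TestFun {S : Type*} [PseudoMetricSpace S] (C : Set S) : Type _ :=
  {f : (Cᶜ : Set S) →ᵇ ℝ≥0 //
    ∃ r : ℝ, 0 < r ∧ ∀ x : (Cᶜ : Set S), (x : S) ∈ Metric.thickening r C → f x = 0}

/-- The topology of `M(S \ C)`: a base is given by the finite intersections of the sets
`{ν | |∫ f dν - ∫ f dμ| < ε}` with `f` a test function, i.e. it is the coarsest topology which makes
all the maps `μ ↦ ∫ f dμ` continuous. -/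
noncomputable instance {S : Type*} [PseudoMetricSpace S] [MeasurableSpace S] (C : Set S) :
    TopologicalSpace (MO C) :=
  TopologicalSpace.induced
    (fun (μ : MO C) (f : TestFun C) => ∫ x, (f.1 x : ℝ) ∂μ.toMeasure) Pi.topologicalSpace

/-- The restriction to the subspace `S \ C` of a measure on `S`. -/
noncomputable def restrictCompl {S : Type*} [MeasurableSpace S] (C : Set S) (μ : Measure S) :
    Measure (Cᶜ : Set S) :=
  μ.comap Subtype.val

/-! ### The space of double-sided sequences -/

/-- Double-sided sequences of nonnegative real numbers. -/
def RZ : Type := ℤ → ℝ≥0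

namespace RZ

/-- `d(x, y) = ∑ i, (|x i - y i| ∧ 1) / 2 ^ (|i| + 1)`. -/
noncomputable def distZ (x y : RZ) : ℝ :=
  ∑' i : ℤ, min |(x i : ℝ) - (y i : ℝ)| 1 / 2 ^ (i.natAbs + 1)

theorem summable_weight : Summable (fun i : ℤ => (1 : ℝ) / 2 ^ (i.natAbs + 1)) := by
  have h : Summable (fun n : ℕ => (1 : ℝ) / 2 ^ (n + 1)) := by
    have := (summable_nat_add_iff (f := fun n : ℕ => ((1 : ℝ) / 2) ^ n) 1).2
      summable_geometric_two
    simpa [div_pow] using this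
  refine Summable.of_nat_of_neg ?_ ?_
  · simpa using h
  · simpa using h

theorem term_nonneg (x y : RZ) (i : ℤ) :
    0 ≤ min |(x i : ℝ) - (y i : ℝ)| 1 / 2 ^ (i.natAbs + 1) := by positivity

theorem term_le (x y : RZ) (i : ℤ) :
    min |(x i : ℝ) - (y i : ℝ)| 1 / 2 ^ (i.natAbs + 1) ≤ 1 / 2 ^ (i.natAbs + 1) := by
  gcongr
  exact min_le_right _ _

theorem summable_term (x y : RZ) :
    Summable (fun i : ℤ => min |(x i : ℝ) - (y i : ℝ)| 1 / 2 ^ (i.natAbs + 1)) :=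
  Summable.of_nonneg_of_le (term_nonneg x y) (term_le x y) summable_weight

theorem term_le_distZ (x y : RZ) (i : ℤ) :
    min |(x i : ℝ) - (y i : ℝ)| 1 / 2 ^ (i.natAbs + 1) ≤ distZ x y :=
  (summable_term x y).le_tsum i (fun j _ => term_nonneg x y j)

theorem distZ_self (x : RZ) : distZ x x = 0 := by simp [distZ]

theorem distZ_comm (x y : RZ) : distZ x y = distZ y x := by
  simp only [distZ, abs_sub_comm]

theorem distZ_triangle (x y z : RZ) : distZ x z ≤ distZ x y + distZ y z := by
  unfold distZ
  rw [← (summable_term x y).tsum_add (summable_term y z)]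
  refine (summable_term x z).tsum_le_tsum (fun i => ?_)
    ((summable_term x y).add (summable_term y z))
  rw [← add_div]
  gcongr
  have h := abs_sub_le (x i : ℝ) (y i) (z i)
  have h1 := abs_nonneg ((x i : ℝ) - y i)
  have h2 := abs_nonneg ((y i : ℝ) - z i)
  rcases min_cases |(x i : ℝ) - (y i : ℝ)| 1 with h3 | h3 <;>
  rcases min_cases |(y i : ℝ) - (z i : ℝ)| 1 with h4 | h4 <;>
  rcases min_cases |(x i : ℝ) - (z i : ℝ)| 1 with h5 | h5 <;> linarith

theorem eq_of_distZ_eq_zero {x y : RZ} (h : distZ x y = 0) : x = y := by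
  funext i
  have h1 := term_le_distZ x y i
  rw [h] at h1
  have h2 : min |(x i : ℝ) - (y i : ℝ)| 1 ≤ 0 := by
    by_contra hc
    push Not at hc
    have : 0 < min |(x i : ℝ) - (y i : ℝ)| 1 / 2 ^ (i.natAbs + 1) := by positivity
    linarith
  have h3 : |(x i : ℝ) - (y i : ℝ)| ≤ 0 := by
    rcases min_le_iff.1 h2 with h | h
    · exact h
    · linarith
  have h4 := abs_nonpos_iff.1 h3
  exact NNReal.coe_injective (by linarith)

/-- The metric of the sequence space, with the topology not yet identified. -/
noncomputable abbrev metricAux : MetricSpace RZ where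
  dist := distZ
  dist_self := distZ_self
  dist_comm := distZ_comm
  dist_triangle := distZ_triangle
  eq_of_dist_eq_zero := eq_of_distZ_eq_zero

/-- The topology of coordinatewise convergence. -/
instance : TopologicalSpace RZ := inferInstanceAs (TopologicalSpace (ℤ → ℝ≥0))

theorem continuous_distZ (x : RZ) : Continuous (fun y : RZ => distZ y x) := by
  unfold distZ
  refine continuous_tsum (fun i => ?_) summable_weight (fun i y => ?_)
  · have : Continuous (fun y : RZ => y i) := continuous_apply (A := fun _ : ℤ => ℝ≥0) i
    fun_prop
  · rw [Real.norm_of_nonneg (term_nonneg y x i)]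
    exact term_le y x i

/-- The metric induces the topology of coordinatewise convergence. -/
theorem topology_eq :
    (inferInstance : TopologicalSpace RZ) = metricAux.toUniformSpace.toTopologicalSpace := by
  refine TopologicalSpace.ext_nhds fun x => le_antisymm ?_ ?_
  · let _ := metricAux
    rw [(Metric.nhds_basis_ball (x := x)).ge_iff]
    intro ε hε
    have h := (continuous_distZ x).tendsto x
    rw [distZ_self] at h
    exact h (Iio_mem_nhds hε)
  · rw [show @nhds RZ (inferInstance : TopologicalSpace RZ) x = ⨅ i : ℤ, comap (fun y : RZ => y i) (𝓝 (x i))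
      from nhds_pi (A := fun _ : ℤ => ℝ≥0), le_iInf_iff]
    intro i
    rw [← tendsto_iff_comap]
    let _ := metricAux
    rw [(Metric.nhds_basis_ball (x := x)).tendsto_iff Metric.nhds_basis_ball]
    intro ε hε
    refine ⟨min ε 1 / 2 ^ (i.natAbs + 1), by positivity, fun y hy => ?_⟩
    have h1 : distZ y x < min ε 1 / 2 ^ (i.natAbs + 1) := hy
    have h2 := (term_le_distZ y x i).trans_lt h1
    rw [div_lt_div_iff_of_pos_right (by positivity)] at h2
    rw [Metric.mem_ball, NNReal.dist_eq]
    rcases min_lt_iff.1 h2 with h | h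
    · exact h.trans_le (min_le_left _ _)
    · exact absurd (h.trans_le (min_le_right _ _)) (lt_irrefl _)

/-- The metric `d` on the sequence space. -/
noncomputable instance : MetricSpace RZ := metricAux.replaceTopology topology_eq

/-- The Borel σ-algebra (equivalently, the product σ-algebra). -/
instance : MeasurableSpace RZ := inferInstanceAs (MeasurableSpace (ℤ → ℝ≥0))

instance : BorelSpace RZ := inferInstanceAs (BorelSpace (ℤ → ℝ≥0))

theorem dist_def (x y : RZ) :
    dist x y = ∑' i : ℤ, min |(x i : ℝ) - (y i : ℝ)| 1 / 2 ^ (i.natAbs + 1) := rfl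

/-- The sequence with all components `0`, except for component `i`, which is `1`. -/
def e (i : ℤ) : RZ := fun n => if n = i then 1 else 0

/-- Pointwise multiplication of a sequence by a number. -/
def scale (c : ℝ≥0) (x : RZ) : RZ := fun n => c * x n

/-- The linear combination `∑ k, z k • e (i k)`. -/
def comb {n : ℕ} (i : Fin n → ℤ) (z : Fin n → ℝ≥0) : RZ := fun l => ∑ k, z k * e (i k) l

/-- The sequences with at most `j` positive components. -/
def Cle (j : ℕ) : Set RZ := {x | {i : ℤ | 0 < x i}.encard ≤ j}

/-- The moving average map `T^m` with coefficients `ψ`. -/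
def T (ψ : ℕ → ℝ≥0) (m : ℕ) (z : RZ) : RZ :=
  fun k => ∑ j ∈ Finset.range (m + 1), ψ j * z (k - j)

/-- Coordinates are measurable. -/
theorem measurable_coord (i : ℤ) : Measurable (fun x : RZ => x i) :=
  measurable_pi_apply (X := fun _ : ℤ => ℝ≥0) i

theorem measurable_of_coord {β : Type*} [MeasurableSpace β] {f : β → RZ}
    (h : ∀ i, Measurable (fun b => f b i)) : Measurable f :=
  measurable_pi_lambda (X := fun _ : ℤ => ℝ≥0) f h

theorem measurable_T (ψ : ℕ → ℝ≥0) (m : ℕ) : Measurable (T ψ m) :=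
  measurable_of_coord fun k =>
    Finset.measurable_sum _ fun j _ => (measurable_coord (k - j)).const_mul (ψ j)

theorem measurable_comb {n : ℕ} (i : Fin n → ℤ) : Measurable (comb i) :=
  measurable_of_coord fun l =>
    Finset.measurable_sum _ fun k _ => 
      (measurable_pi_apply (X := fun _ : Fin n => ℝ≥0) k).mul_const (e (i k) l)

end RZ

/-! ### The limit measures -/

/-- The measure `ν_α` on `[0, ∞)` with Lebesgue density `α x ^ (-α - 1)` on `(0, ∞)`, so that
`ν_α (x, ∞) = x ^ (-α)` for `x > 0` and `ν_α {0} = 0`. -/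
noncomputable def nuAlpha (α : ℝ) : Measure ℝ≥0 :=
  ((volume.restrict (Ioi (0 : ℝ))).withDensity
    (fun x : ℝ => ENNReal.ofReal (α * x ^ (-α - 1)))).map Real.toNNReal

theorem nuAlpha_Ioi {α : ℝ} (hα : 0 < α) {x : ℝ≥0} (hx : 0 < x) :
    nuAlpha α (Ioi x) = ENNReal.ofReal ((x : ℝ) ^ (-α)) := by
  have hx' : (0 : ℝ) < x := hx
  have hpre : Real.toNNReal ⁻¹' (Ioi x) = Ioi (x : ℝ) := by
    ext y
    exact Real.lt_toNNReal_iff_coe_lt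
  have hInt : IntegrableOn (fun y : ℝ => α * y ^ (-α - 1)) (Ioi (x : ℝ)) :=
    (integrableOn_Ioi_rpow_of_lt (by linarith) hx').const_mul α
  rw [nuAlpha, Measure.map_apply measurable_real_toNNReal measurableSet_Ioi, hpre,
    withDensity_apply _ measurableSet_Ioi, Measure.restrict_restrict measurableSet_Ioi,
    inter_eq_left.2 (Ioi_subset_Ioi hx'.le), ← ofReal_integral_eq_lintegral_ofReal hInt]
  · rw [integral_const_mul, integral_Ioi_rpow_of_lt (by linarith) hx']
    congr 1
    rw [show -α - 1 + 1 = -α by ring]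
    field_simp
  · refine (ae_restrict_iff' measurableSet_Ioi).2 (Eventually.of_forall fun y hy => ?_)
    have : (0 : ℝ) < y := hx'.trans hy
    positivity

theorem nuAlpha_zero (α : ℝ) : nuAlpha α {0} = 0 := by
  rw [nuAlpha, Measure.map_apply measurable_real_toNNReal (measurableSet_singleton _)]
  refine withDensity_absolutelyContinuous _ _ ?_
  have hpre : Real.toNNReal ⁻¹' {0} = Iic (0 : ℝ) := by
    ext y
    simp
  rw [hpre, Measure.restrict_apply measurableSet_Iic, Iic_inter_Ioi, Ioc_self,
    measure_empty]

theorem nuAlpha_sigmaFinite {α : ℝ} (hα : 0 < α) : SigmaFinite (nuAlpha α) := by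
  refine ⟨⟨⟨fun n : ℕ => {0} ∪ Ioi ((1 : ℝ≥0) / (n + 1)), fun _ => trivial, fun n => ?_, ?_⟩⟩⟩
  · refine (measure_union_le _ _).trans_lt ?_
    rw [nuAlpha_zero, nuAlpha_Ioi hα (by positivity)]
    simp
  · refine eq_univ_of_forall fun x => ?_
    rcases eq_or_ne x 0 with rfl | hx
    · exact mem_iUnion.2 ⟨0, Or.inl rfl⟩
    · obtain ⟨n, hn⟩ := exists_nat_one_div_lt (K := ℝ≥0) (pos_iff_ne_zero.2 hx)
      exact mem_iUnion.2 ⟨n, Or.inr hn⟩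

/-- The measure `μ^(j)`: the sum, over the subsets `{i_1 < ⋯ < i_{j+1}}` of `ℤ` of size `j + 1`, of
`∫ 1{∑ k, z_k e_{i_k} ∈ ·} ν_α(dz_1) ⋯ ν_α(dz_{j+1})`. -/
noncomputable def muLim (α : ℝ) (j : ℕ) : Measure RZ :=
  Measure.sum fun i : Fin (j + 1) ↪o ℤ =>
    (Measure.pi fun _ : Fin (j + 1) => nuAlpha α).map (RZ.comb i)

/-- The measure `∑ ∫ 1{T^m (∑ k, z_k e_{i_k}) ∈ ·} ν_α(dz_1) ⋯ ν_α(dz_{j+1})`, summed over the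
subsets `{i_1 < ⋯ < i_{j+1}}` of `ℤ` of size `j + 1`. -/
noncomputable def muLimMA (α : ℝ) (ψ : ℕ → ℝ≥0) (m j : ℕ) : Measure RZ :=
  Measure.sum fun i : Fin (j + 1) ↪o ℤ =>
    (Measure.pi fun _ : Fin (j + 1) => nuAlpha α).map (fun z => RZ.T ψ m (RZ.comb i z))

/-! ### The processes -/

/-- The scaling function `t ↦ b (t ^ (1 / (j + 1)))`. -/
noncomputable def scaling (b : ℝ → ℝ≥0) (j : ℕ) (t : ℝ) : ℝ≥0 := b (t ^ (1 / ((j : ℝ) + 1)))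

/-- The random sequence formed by the random variables `Z i`. -/
def seqOf {Ω : Type*} (Z : ℤ → Ω → ℝ≥0) (ω : Ω) : RZ := fun i => Z i ω

/-- The finite moving average process: `X^m_k = ∑_{j=0}^m ψ_j Z_{k-j}`. -/
def maProc {Ω : Type*} (ψ : ℕ → ℝ≥0) (m : ℕ) (Z : ℤ → Ω → ℝ≥0) (k : ℤ) (ω : Ω) : ℝ≥0 :=
  ∑ j ∈ Finset.range (m + 1), ψ j * Z (k - j) ω

/-- The measure `t P[Y / b(t^{1/(j+1)}) ∈ ·]` of a random sequence `Y`. -/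
noncomputable def scaledLaw {Ω : Type*} [MeasurableSpace Ω] (P : Measure Ω) (b : ℝ → ℝ≥0)
    (Y : ℤ → Ω → ℝ≥0) (j : ℕ) (t : ℝ) : Measure RZ :=
  ENNReal.ofReal t • P.map (fun ω => RZ.scale (scaling b j t)⁻¹ (seqOf Y ω))

/-! By independence, the probability that `j + 1` given coordinates of `Z` all exceed fixed
multiples of `b (t ^ (1 / (j + 1)))` is of order `(t ^ (-1 / (j + 1))) ^ (j + 1) = 1 / t`. The
prefactor `t` therefore splits into one factor `t ^ (1 / (j + 1))` per large coordinate, each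
producing a copy of `nuAlpha α`, while every other scaled coordinate tends to `0` in probability.
Restricted to the sequences that are large at these places, the scaled law converges weakly to the
corresponding summand of `muLim`. On cylinders over cells this is a convergence of finite products,
and such cylinders determine weak convergence (`tendsto_restrict_largeAt`).

The passage to the images under `T` rests on `exists_mem_largeSet_of_notMem_thickening`: if `T ψ m
z` has distance at least `r` from the image of `Cle j`, then `z` has more than `j` coordinates above
a fixed level in a fixed finite window. Otherwise, deleting the small coordinates in the window and
everything outside it would leave a point of `Cle j` whose image is within `r`. A test function on
the image side thus pulls back to a bounded continuous function supported in a `largeSet`. A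
partition of unity (`exists_decomposition`) cuts it into finitely many pieces, each supported where
`j + 1` given places are large, and on each piece only one summand of `muLim` counts.

Positivity of `ψ 0` enters twice: it bounds `z` coordinatewise by `T ψ m z`, so images of closed
sets are closed by compactness, and it makes `T` injective on finitely supported sequences, so the
limit charges the complement of the removed set. -/

/-! ### Increasing lists of integers -/

/-- A set of integers has more than `j` elements iff `j + 1` of them can be listed in increasing
order. -/
theorem lt_encard_iff_exists_orderEmbedding {s : Set ℤ} {j : ℕ} :
    (j : ℕ∞) < s.encard ↔ ∃ i : Fin (j + 1) ↪o ℤ, ∀ k, i k ∈ s := by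
  constructor
  · intro h
    have h' : ((j + 1 : ℕ) : ℕ∞) ≤ s.encard := by
      push_cast
      exact Order.add_one_le_of_lt h
    obtain ⟨t, hts, ht⟩ := exists_subset_encard_eq h'
    have hfin : t.Finite := finite_of_encard_eq_coe ht
    have hcard : hfin.toFinset.card = j + 1 := by
      rw [hfin.encard_eq_coe_toFinset_card] at ht
      exact_mod_cast ht
    refine ⟨hfin.toFinset.orderEmbOfFin hcard, fun k => hts ?_⟩
    exact hfin.mem_toFinset.1 (Finset.orderEmbOfFin_mem hfin.toFinset hcard k)
  · rintro ⟨i, hi⟩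
    have h1 : (range i).encard = ((j + 1 : ℕ) : ℕ∞) := by
      rw [← image_univ, i.injective.encard_image]
      simp
    have h2 : (range i).encard ≤ s.encard := encard_le_encard (range_subset_iff.2 hi)
    rw [h1] at h2
    refine lt_of_lt_of_le ?_ h2
    exact_mod_cast Nat.lt_succ_self j

/-- Increasing lists of integers with the same length are equal if one contains the other. -/
theorem orderEmbedding_eq_of_range_subset {n : ℕ} {i i' : Fin n ↪o ℤ}
    (h : ∀ k, i' k ∈ range i) : i' = i := by
  have hr : range i' = range i := by
    refine eq_of_subset_of_ncard_le (range_subset_iff.2 h) ?_ (finite_range i)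
    rw [← image_univ, ← image_univ, ncard_image_of_injective _ i.injective,
      ncard_image_of_injective _ i'.injective]
  exact OrderEmbedding.range_inj.1 hr

/-- There are finitely many increasing lists of a given length in a finite set of integers. -/
theorem finite_orderEmbedding_into (n : ℕ) (J : Finset ℤ) :
    {i : Fin n ↪o ℤ | ∀ k, i k ∈ J}.Finite := by
  have h : (univ.pi fun _ : Fin n => (J : Set ℤ)).Finite := Finite.pi fun _ => J.finite_toSet
  refine (h.preimage (f := fun (i : Fin n ↪o ℤ) (k : Fin n) => i k) ?_).subset ?_
  · intro i _ i' _ hii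
    exact DFunLike.coe_injective hii
  · intro i hi k _
    exact hi k

/-! ### The sets `Cle j`, the moving average map and its images -/

namespace RZ

instance : SecondCountableTopology RZ :=
  inferInstanceAs (SecondCountableTopology (ℤ → ℝ≥0))

theorem continuous_coord (i : ℤ) : Continuous (fun x : RZ => x i) :=
  continuous_apply (A := fun _ : ℤ => ℝ≥0) i

theorem continuous_of_coord {β : Type*} [TopologicalSpace β] {f : β → RZ}
    (h : ∀ i, Continuous (fun b => f b i)) : Continuous f :=
  continuous_pi (A := fun _ : ℤ => ℝ≥0) h

theorem continuous_T (ψ : ℕ → ℝ≥0) (m : ℕ) : Continuous (T ψ m) :=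
  continuous_of_coord fun k =>
    continuous_finsetSum _ fun l _ => (continuous_coord (k - l)).const_mul (ψ l)

theorem T_scale (ψ : ℕ → ℝ≥0) (m : ℕ) (c : ℝ≥0) (z : RZ) :
    T ψ m (scale c z) = scale c (T ψ m z) := by
  funext k
  simp only [T, scale, Finset.mul_sum]
  exact Finset.sum_congr rfl fun l _ => mul_left_comm _ _ _

/-- All terms are nonnegative and the left side is the term `l = 0`. This is the coordinatewise
bound behind the closedness of images. -/
theorem mul_le_T (ψ : ℕ → ℝ≥0) (m : ℕ) (z : RZ) (k : ℤ) : ψ 0 * z k ≤ T ψ m z k := by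
  have h := Finset.single_le_sum (f := fun l : ℕ => ψ l * z (k - l))
    (fun _ _ => zero_le) (Finset.mem_range.2 m.succ_pos)
  simpa [T] using h

theorem mem_nhds_of_coord {x : RZ} {U : Set RZ} (hU : U ∈ 𝓝 x) :
    ∃ (J : Finset ℤ) (t : ℤ → Set ℝ≥0), (∀ i, t i ∈ 𝓝 (x i)) ∧ (J : Set ℤ).pi t ⊆ U := by
  have h : U ∈ Filter.pi fun i => 𝓝 (x i) :=
    (nhds_pi (A := fun _ : ℤ => ℝ≥0) (a := x)).ge hU
  obtain ⟨I, hI, t, ht, hs⟩ := Filter.mem_pi.1 h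
  exact ⟨hI.toFinset, t, ht, by simpa using hs⟩

theorem notMem_Cle_iff {j : ℕ} {x : RZ} :
    x ∉ Cle j ↔ ∃ i : Fin (j + 1) ↪o ℤ, ∀ k, 0 < x (i k) := by
  rw [Cle, mem_ofPred_eq, not_le, lt_encard_iff_exists_orderEmbedding]
  rfl

theorem isClosed_Cle (j : ℕ) : IsClosed (Cle j) := by
  have h : (Cle j)ᶜ = ⋃ i : Fin (j + 1) ↪o ℤ, ⋂ k, {x : RZ | 0 < x (i k)} := by
    ext x
    simp [notMem_Cle_iff]
  rw [← isOpen_compl_iff, h]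
  exact isOpen_iUnion fun i => isOpen_iInter_of_finite fun k =>
    isOpen_lt continuous_const (continuous_coord (i k))

theorem Cle_mono {j k : ℕ} (h : j ≤ k) : Cle j ⊆ Cle k := fun x hx => by
  have hx' : {i : ℤ | 0 < x i}.encard ≤ j := hx
  exact hx'.trans (by exact_mod_cast h)

theorem scale_mem_Cle {j : ℕ} {x : RZ} (hx : x ∈ Cle j) (c : ℝ≥0) : scale c x ∈ Cle j := by
  have hx' : {i : ℤ | 0 < x i}.encard ≤ j := hx
  refine le_trans (encard_le_encard fun i hi => ?_) hx'
  exact pos_of_mul_pos_right (a := c) (b := x i) hi zero_le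

/-- The image of a closed set under the moving average map is closed. -/
theorem isClosed_image_T {ψ : ℕ → ℝ≥0} (hψ : 0 < ψ 0) (m : ℕ) {C : Set RZ} (hC : IsClosed C) :
    IsClosed (T ψ m '' C) := by
  refine IsSeqClosed.isClosed fun y y₀ hy hlim => ?_
  choose z hz hzy using hy
  have hcoord : ∀ k, ∃ M, ∀ n, z n k ≤ M := fun k => by
    have h1 : Tendsto (fun n => y n k) atTop (𝓝 (y₀ k)) :=
      ((continuous_coord k).tendsto y₀).comp hlim
    obtain ⟨M, hM⟩ := h1.bddAbove_range
    refine ⟨(ψ 0)⁻¹ * M, fun n => ?_⟩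
    rw [le_inv_mul_iff₀ hψ]
    refine (mul_le_T ψ m (z n) k).trans ?_
    rw [hzy]
    exact hM (mem_range_self n)
  choose M hM using hcoord
  -- By Tychonoff, the preimages `z n` stay in a compact box, so a subsequence converges; its limit
  -- is a preimage of `y₀`.
  have hK : @IsCompact RZ _ (univ.pi fun k : ℤ => Icc (0 : ℝ≥0) (M k)) :=
    isCompact_univ_pi fun k => isCompact_Icc
  obtain ⟨z₀, -, φ, hφ, hz₀⟩ := hK.tendsto_subseq (x := z) fun n k _ => ⟨zero_le (a := z n k), hM k n⟩
  refine ⟨z₀, hC.mem_of_tendsto hz₀ (Eventually.of_forall fun n => hz _), ?_⟩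
  have h1 : Tendsto (fun n => T ψ m (z (φ n))) atTop (𝓝 (T ψ m z₀)) :=
    ((continuous_T ψ m).tendsto z₀).comp hz₀
  refine tendsto_nhds_unique h1 ?_
  simp only [hzy]
  exact hlim.comp hφ.tendsto_atTop

theorem finite_support_of_mem_Cle {j : ℕ} {x : RZ} (hx : x ∈ Cle j) : {i : ℤ | 0 < x i}.Finite :=
  finite_of_encard_le_coe (k := j) hx

/-- The moving average map is injective on the sequences with finite support. -/
theorem T_injOn_finite_support {ψ : ℕ → ℝ≥0} (hψ : 0 < ψ 0) (m : ℕ) {x y : RZ}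
    (hx : {i : ℤ | 0 < x i}.Finite) (hy : {i : ℤ | 0 < y i}.Finite) (h : T ψ m x = T ψ m y) :
    x = y := by
  by_contra hne
  have hfin : {i : ℤ | x i ≠ y i}.Finite := by
    refine (hx.union hy).subset fun i hi => ?_
    rcases eq_or_ne (x i) 0 with h0 | h0
    · right
      refine (pos_iff_ne_zero (a := y i)).2 fun h1 => hi ?_
      rw [h0, h1]
    · exact Or.inl ((pos_iff_ne_zero (a := x i)).2 h0)
  have hnon : {i : ℤ | x i ≠ y i}.Nonempty := by
    by_contra hemp
    refine hne (funext fun i => ?_)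
    by_contra hi
    exact hemp ⟨i, hi⟩
  -- At the smallest index where `x` and `y` differ, all terms with `l > 0` agree, so only `ψ 0 * x
  -- k = ψ 0 * y k` remains. Finite support guarantees that such an index exists.
  obtain ⟨k, hk, hmin⟩ := hfin.exists_minimal hnon
  have heq : ∀ l < k, x l = y l := fun l hl => by
    by_contra hl'
    exact absurd (hmin hl' hl.le) (not_le.2 hl)
  have h1 := congrFun h k
  simp only [T, Finset.sum_range_succ'] at h1
  have h2 : ∀ l ∈ Finset.range m, ψ (l + 1) * x (k - ((l + 1 : ℕ) : ℤ))
      = ψ (l + 1) * y (k - ((l + 1 : ℕ) : ℤ)) := fun l _ => by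
    rw [heq _ (by push_cast; omega)]
  rw [Finset.sum_congr rfl h2, add_right_inj] at h1
  have h3 := mul_left_cancel₀ hψ.ne' h1
  exact hk (by simpa using h3)

theorem comb_apply {n : ℕ} (i : Fin n ↪o ℤ) (z : Fin n → ℝ≥0) (k : Fin n) :
    comb i z (i k) = z k := by
  simp [comb, e, i.injective.eq_iff]

theorem comb_of_notMem {n : ℕ} (i : Fin n ↪o ℤ) (z : Fin n → ℝ≥0) {l : ℤ} (hl : l ∉ range i) :
    comb i z l = 0 :=
  Finset.sum_eq_zero fun k _ => by
    have : l ≠ i k := fun h => hl ⟨k, h.symm⟩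
    simp [e, this]

theorem comb_mem_Cle {n : ℕ} (i : Fin n ↪o ℤ) (z : Fin n → ℝ≥0) : comb i z ∈ Cle n := by
  have h : {l : ℤ | 0 < comb i z l} ⊆ range i := fun l hl => by
    by_contra hl'
    exact ne_of_gt (show 0 < comb i z l from hl) (comb_of_notMem i z hl')
  refine (encard_le_encard h).trans ?_
  rw [← image_univ]
  refine (encard_image_le _ _).trans ?_
  simp

/-- The support of `comb i z` lies in the range of `i`, which has no room for another list of the
same length. This is what separates the summands of `muLim` from each other. -/
theorem eq_of_comb_pos {n : ℕ} {i i' : Fin n ↪o ℤ} {z : Fin n → ℝ≥0}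
    (h : ∀ k, 0 < comb i z (i' k)) : i' = i :=
  orderEmbedding_eq_of_range_subset fun k => by
    by_contra hk
    exact (h k).ne' (comb_of_notMem i z hk)

/-- By injectivity on finite supports, a preimage in `Cle j` would have to be `comb i z` itself,
which has `j + 1` positive components. -/
theorem T_comb_notMem {ψ : ℕ → ℝ≥0} (hψ : 0 < ψ 0) (m : ℕ) {j : ℕ} (i : Fin (j + 1) ↪o ℤ)
    {z : Fin (j + 1) → ℝ≥0} (hz : ∀ k, 0 < z k) : T ψ m (comb i z) ∉ T ψ m '' Cle j := by
  rintro ⟨y, hy, hyz⟩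
  have h := T_injOn_finite_support hψ m (finite_support_of_mem_Cle hy)
    (finite_support_of_mem_Cle (comb_mem_Cle i z)) hyz
  rw [h] at hy
  exact notMem_Cle_iff.2 ⟨i, fun k => by rw [comb_apply]; exact hz k⟩ hy

/-- The sequence with all components `0`. -/
def null : RZ := fun _ => 0

theorem T_null (ψ : ℕ → ℝ≥0) (m : ℕ) : T ψ m null = null := by
  funext k
  simp [T, null]

/-- The sequences with more than `j` components larger than `ε` at the places in `J`. -/
def largeSet (j : ℕ) (J : Finset ℤ) (ε : ℝ≥0) : Set RZ :=
  {z | ∃ i : Fin (j + 1) ↪o ℤ, (∀ k, i k ∈ J) ∧ ∀ k, ε < z (i k)}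

/-- The metric depends only on coordinate differences and `T` is additive. -/
theorem dist_T_add (ψ : ℕ → ℝ≥0) (m : ℕ) (x w : RZ) :
    dist (T ψ m fun i => x i + w i) (T ψ m x) = dist (T ψ m w) null := by
  simp only [dist_def, T, null, mul_add, Finset.sum_add_distrib, NNReal.coe_add, add_sub_cancel_left,
    NNReal.coe_zero, sub_zero]

/-- A sequence whose moving average is far from `T^m(C_{≤ j})` has more than `j` large components
in a fixed window. -/
theorem exists_mem_largeSet_of_notMem_thickening (ψ : ℕ → ℝ≥0) (m j : ℕ) {r : ℝ} (hr : 0 < r) :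
    ∃ (J : Finset ℤ) (ε : ℝ≥0), 0 < ε ∧
      ∀ z : RZ, T ψ m z ∉ Metric.thickening r (T ψ m '' Cle j) → z ∈ largeSet j J ε := by
  have hU : {w : RZ | dist (T ψ m w) null < r} ∈ 𝓝 null := by
    have hc : Continuous fun w : RZ => dist (T ψ m w) null :=
      (continuous_T ψ m).dist continuous_const
    refine hc.continuousAt.eventually_lt continuousAt_const ?_
    rw [T_null, dist_self]
    exact hr
  obtain ⟨J, t, ht, htU⟩ := mem_nhds_of_coord hU
  have hex : ∀ i, ∃ ε : ℝ≥0, 0 < ε ∧ Iic ε ⊆ t i := fun i => by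
    have h1 : t i ∈ 𝓝 (0 : ℝ≥0) := ht i
    obtain ⟨ε, hε, hεt⟩ := (nhds_bot_basis (α := ℝ≥0)).mem_iff.1 h1
    have hε' : (0 : ℝ≥0) < ε := hε
    exact ⟨ε / 2, half_pos hε', fun a ha => hεt (lt_of_le_of_lt ha (NNReal.half_lt_self hε'.ne'))⟩
  choose ε hε hεt using hex
  have hne : ∃ δ : ℝ≥0, 0 < δ ∧ ∀ i ∈ J, δ ≤ ε i := by
    rcases J.eq_empty_or_nonempty with rfl | hJ
    · exact ⟨1, one_pos, by simp⟩
    · exact ⟨J.inf' hJ ε, (Finset.lt_inf'_iff hJ).2 fun i _ => hε i,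
        fun i hi => Finset.inf'_le ε hi⟩
  obtain ⟨δ, hδ, hδε⟩ := hne
  refine ⟨J, δ, hδ, fun z hz => ?_⟩
  by_contra hzA
  classical
  -- Split `z = x + w`, with `x` carrying the large coordinates in the window and `w` the rest. If
  -- `z` is not in the large set then `x ∈ Cle j`, and `w` is so close to `null` that its image has
  -- distance less than `r` from `null`.
  let S : Set ℤ := {i | i ∈ J ∧ δ < z i}
  let x : RZ := fun i => if i ∈ S then z i else 0
  let w : RZ := fun i => if i ∈ S then 0 else z i
  have hxw : (fun i => x i + w i : RZ) = z := by
    funext i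
    by_cases hi : i ∈ S <;> simp [x, w, hi]
  have hx : x ∈ Cle j := by
    have hS : S.encard ≤ j := by
      by_contra hS
      rw [not_le, lt_encard_iff_exists_orderEmbedding] at hS
      obtain ⟨i, hi⟩ := hS
      exact hzA ⟨i, fun k => (hi k).1, fun k => (hi k).2⟩
    refine (encard_le_encard fun i hi => ?_).trans hS
    by_contra hi'
    exact absurd hi (by simp [x, hi'])
  have hw : w ∈ {w : RZ | dist (T ψ m w) null < r} := by
    refine htU fun i hi => hεt i (le_trans ?_ (hδε i hi))
    by_cases hiS : i ∈ S
    · simp [w, hiS]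
    · simp only [w, hiS, if_false]
      by_contra hlt
      exact hiS ⟨hi, not_le.1 hlt⟩
  refine hz (Metric.mem_thickening_iff.2 ⟨T ψ m x, mem_image_of_mem _ hx, ?_⟩)
  rw [← hxw, dist_T_add]
  exact hw

end RZ

/-! ### Weak convergence along a π-system, and cells of the half-line -/

/-- If finite measures converge along a π-system which contains the whole space and arbitrarily
small neighbourhoods of every point, then they converge weakly, provided the limit is nonzero. -/
theorem IsPiSystem.tendsto_finiteMeasure_of_tendsto_of_mem {X ι : Type*} [MeasurableSpace X]
    [TopologicalSpace X] [SecondCountableTopology X] [OpensMeasurableSpace X]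
    {S : Set (Set X)} (hS : IsPiSystem S) {μ : ι → FiniteMeasure X} {ν : FiniteMeasure X}
    {l : Filter ι} [l.IsCountablyGenerated] (huniv : univ ∈ S)
    (hmeas : ∀ s ∈ S, MeasurableSet s)
    (hnhds : ∀ (u : Set X), IsOpen u → ∀ x ∈ u, ∃ s ∈ S, s ∈ 𝓝 x ∧ s ⊆ u)
    (h : ∀ s ∈ S, Tendsto (fun i ↦ μ i s) l (𝓝 (ν s))) (hν : ν ≠ 0) :
    Tendsto μ l (𝓝 ν) := by
  have hne : Nonempty X := by
    by_contra hX
    rw [not_nonempty_iff] at hX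
    refine hν (Subtype.ext ?_)
    exact Measure.eq_zero_of_isEmpty _
  have hmass : Tendsto (fun i ↦ (μ i).mass) l (𝓝 ν.mass) := h univ huniv
  have hν0 : ν.mass ≠ 0 := ν.mass_nonzero_iff.2 hν
  -- The masses converge because the whole space is in `S`. As the limit mass is nonzero, dividing
  -- by the masses reduces the claim to probability measures.
  refine FiniteMeasure.tendsto_of_tendsto_normalize_testAgainstNN_of_tendsto_mass ?_ hmass
  refine hS.tendsto_probabilityMeasure_of_tendsto_of_mem hmeas hnhds fun s hs => ?_
  rw [ν.normalize_eq_of_nonzero hν]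
  refine ((hmass.inv₀ hν0).mul (h s hs)).congr' ?_
  filter_upwards [hmass.eventually_ne hν0] with i hi
  exact ((μ i).normalize_eq_of_nonzero ((μ i).mass_nonzero_iff.1 hi) s).symm

/-- The intervals `[0, c]` and `(a, c]` with `a, c > 0`, and the half-line itself. -/
def cellFamily : Set (Set ℝ≥0) :=
  {B | B = univ ∨ (∃ c, 0 < c ∧ B = Iic c) ∨ ∃ a c, 0 < a ∧ B = Ioc a c}

theorem isPiSystem_cellFamily : IsPiSystem cellFamily := by
  rintro B₁ h₁ B₂ h₂ -
  rcases h₁ with rfl | ⟨c, hc, rfl⟩ | ⟨a, c, ha, rfl⟩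
  · rwa [univ_inter]
  · rcases h₂ with rfl | ⟨c', hc', rfl⟩ | ⟨a', c', ha', rfl⟩
    · rw [inter_univ]
      exact Or.inr (Or.inl ⟨c, hc, rfl⟩)
    · exact Or.inr (Or.inl ⟨min c c', lt_min hc hc', Iic_inter_Iic⟩)
    · refine Or.inr (Or.inr ⟨a', min c c', ha', ?_⟩)
      ext x
      simp only [mem_inter_iff, mem_Iic, mem_Ioc, le_min_iff]
      tauto
  · rcases h₂ with rfl | ⟨c', hc', rfl⟩ | ⟨a', c', ha', rfl⟩
    · rw [inter_univ]
      exact Or.inr (Or.inr ⟨a, c, ha, rfl⟩)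
    · refine Or.inr (Or.inr ⟨a, min c c', ha, ?_⟩)
      ext x
      simp only [mem_inter_iff, mem_Iic, mem_Ioc, le_min_iff]
      tauto
    · exact Or.inr (Or.inr ⟨max a a', min c c', lt_max_of_lt_left ha, Ioc_inter_Ioc⟩)

theorem measurableSet_of_mem_cellFamily {B : Set ℝ≥0} (hB : B ∈ cellFamily) :
    MeasurableSet B := by
  rcases hB with rfl | ⟨c, hc, rfl⟩ | ⟨a, c, ha, rfl⟩
  exacts [MeasurableSet.univ, measurableSet_Iic, measurableSet_Ioc]

theorem exists_cellFamily_nhds {x : ℝ≥0} {V : Set ℝ≥0} (hV : V ∈ 𝓝 x) :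
    ∃ B ∈ cellFamily, B ∈ 𝓝 x ∧ B ⊆ V := by
  rcases eq_or_ne x 0 with rfl | hx
  · obtain ⟨c, hc, hcV⟩ := (nhds_bot_basis (α := ℝ≥0)).mem_iff.1 hV
    have hc' : (0 : ℝ≥0) < c := hc
    exact ⟨Iic (c / 2), Or.inr (Or.inl ⟨_, half_pos hc', rfl⟩), Iic_mem_nhds (half_pos hc'),
      fun y hy => hcV (lt_of_le_of_lt hy (NNReal.half_lt_self hc'.ne'))⟩
  · obtain ⟨l, u, ⟨hl, hu⟩, hV'⟩ := (mem_nhds_iff_exists_Ioo_subset'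
      ⟨0, pos_iff_ne_zero.2 hx⟩ ⟨x + 1, lt_add_one x⟩).1 hV
    obtain ⟨a, hla, hax⟩ := exists_between hl
    obtain ⟨c, hxc, hcu⟩ := exists_between hu
    exact ⟨Ioc a c, Or.inr (Or.inr ⟨a, c, lt_of_le_of_lt zero_le hla, rfl⟩), Ioc_mem_nhds hax hxc,
      fun y hy => hV' ⟨hla.trans hy.1, hy.2.trans_lt hcu⟩⟩

/-! ### One-dimensional tails and the scaling function -/

section Tail

variable {Ω : Type*} [MeasurableSpace Ω] {P : Measure Ω} [IsProbabilityMeasure P]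
  {α : ℝ} {X : Ω → ℝ≥0} {b : ℝ → ℝ≥0}

theorem tendsto_tail_Ioi (hα : 0 < α) (hbpos : ∀ t, 0 < t → 0 < b t)
    (hb : ∀ z : ℝ, 0 < z →
      Tendsto (fun t : ℝ => t * P.real {ω | (b t : ℝ) * z < (X ω : ℝ)}) atTop (𝓝 (z ^ (-α))))
    {a : ℝ≥0} (ha : 0 < a) :
    Tendsto (fun u : ℝ => ENNReal.ofReal u * P ((fun ω => (b u)⁻¹ * X ω) ⁻¹' Ioi a)) atTop
      (𝓝 (nuAlpha α (Ioi a))) := by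
  rw [nuAlpha_Ioi hα ha]
  refine (ENNReal.tendsto_ofReal (hb a ha)).congr' ?_
  filter_upwards [eventually_gt_atTop 0] with u hu
  rw [ENNReal.ofReal_mul hu.le, ofReal_measureReal]
  congr 2
  ext ω
  simp only [mem_ofPred_eq, mem_preimage, mem_Ioi]
  rw [lt_inv_mul_iff₀ (hbpos u hu)]
  exact_mod_cast Iff.rfl

theorem tendsto_tail_Ioc (hα : 0 < α) (hX : Measurable X) (hbpos : ∀ t, 0 < t → 0 < b t)
    (hb : ∀ z : ℝ, 0 < z →
      Tendsto (fun t : ℝ => t * P.real {ω | (b t : ℝ) * z < (X ω : ℝ)}) atTop (𝓝 (z ^ (-α))))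
    {a : ℝ≥0} (ha : 0 < a) (c : ℝ≥0) :
    Tendsto (fun u : ℝ => ENNReal.ofReal u * P ((fun ω => (b u)⁻¹ * X ω) ⁻¹' Ioc a c)) atTop
      (𝓝 (nuAlpha α (Ioc a c))) := by
  rcases le_or_gt c a with hca | hac
  · simp [Ioc_eq_empty_of_le hca]
  have hsub : Ioi c ⊆ Ioi a := Ioi_subset_Ioi hac.le
  have hfin : nuAlpha α (Ioi c) ≠ ∞ := by
    rw [nuAlpha_Ioi hα (ha.trans hac)]
    exact ENNReal.ofReal_ne_top
  have hdiff : Ioc a c = Ioi a \ Ioi c := by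
    ext x
    simp
  rw [hdiff, measure_sdiff hsub measurableSet_Ioi.nullMeasurableSet hfin]
  refine (ENNReal.Tendsto.sub (tendsto_tail_Ioi hα hbpos hb ha)
    (tendsto_tail_Ioi hα hbpos hb (ha.trans hac)) (Or.inr hfin)).congr fun u => ?_
  rw [preimage_sdiff, measure_sdiff (preimage_mono hsub)
    ((hX.const_mul _) measurableSet_Ioi).nullMeasurableSet (measure_ne_top _ _),
    ENNReal.mul_sub fun _ _ => ENNReal.ofReal_ne_top]

/-- Cutting at `ε > 0` turns each cell into an interval bounded away from `0`, where the tail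
hypothesis applies. -/
theorem tendsto_tail_cell (hα : 0 < α) (hX : Measurable X) (hbpos : ∀ t, 0 < t → 0 < b t)
    (hb : ∀ z : ℝ, 0 < z →
      Tendsto (fun t : ℝ => t * P.real {ω | (b t : ℝ) * z < (X ω : ℝ)}) atTop (𝓝 (z ^ (-α))))
    {ε : ℝ≥0} (hε : 0 < ε) {B : Set ℝ≥0} (hB : B ∈ cellFamily) :
    Tendsto (fun u : ℝ => ENNReal.ofReal u * P ((fun ω => (b u)⁻¹ * X ω) ⁻¹' (B ∩ Ioi ε))) atTop
      (𝓝 (nuAlpha α (B ∩ Ioi ε))) := by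
  rcases hB with rfl | ⟨c, hc, rfl⟩ | ⟨a, c, ha, rfl⟩
  · rw [univ_inter]
    exact tendsto_tail_Ioi hα hbpos hb hε
  · rw [inter_comm, Ioi_inter_Iic]
    exact tendsto_tail_Ioc hα hX hbpos hb hε c
  · have h : Ioc a c ∩ Ioi ε = Ioc (max a ε) c := by
      ext x
      simp only [mem_inter_iff, mem_Ioi, mem_Ioc, max_lt_iff]
      tauto
    rw [h]
    exact tendsto_tail_Ioc hα hX hbpos hb (lt_max_of_lt_left ha) c

/-- After multiplication by `u → ∞` the limit is still finite, so the probability itself vanishes in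
the limit. -/
theorem tendsto_prob_Ioi (hα : 0 < α) (hbpos : ∀ t, 0 < t → 0 < b t)
    (hb : ∀ z : ℝ, 0 < z →
      Tendsto (fun t : ℝ => t * P.real {ω | (b t : ℝ) * z < (X ω : ℝ)}) atTop (𝓝 (z ^ (-α))))
    {a : ℝ≥0} (ha : 0 < a) :
    Tendsto (fun u : ℝ => P ((fun ω => (b u)⁻¹ * X ω) ⁻¹' Ioi a)) atTop (𝓝 0) := by
  have h1 : Tendsto (fun u : ℝ => (ENNReal.ofReal u)⁻¹) atTop (𝓝 0) := by
    have := ENNReal.tendsto_ofReal_atTop.inv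
    rwa [ENNReal.inv_top] at this
  have hfin : nuAlpha α (Ioi a) ≠ ∞ := by
    rw [nuAlpha_Ioi hα ha]
    exact ENNReal.ofReal_ne_top
  have h2 := ENNReal.Tendsto.mul h1 (Or.inr hfin) (tendsto_tail_Ioi hα hbpos hb ha)
    (Or.inr ENNReal.zero_ne_top)
  rw [zero_mul] at h2
  refine h2.congr' ?_
  filter_upwards [eventually_gt_atTop 0] with u hu
  rw [← mul_assoc, ENNReal.inv_mul_cancel (ENNReal.ofReal_pos.2 hu).ne' ENNReal.ofReal_ne_top,
    one_mul]

/-- The scaled variable tends to `0` in probability, and no cell has `0` on its boundary; this is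
why cells are `Iic c` with `c > 0` or `Ioc a c` with `a > 0`. -/
theorem tendsto_prob_cell (hα : 0 < α) (hX : Measurable X) (hbpos : ∀ t, 0 < t → 0 < b t)
    (hb : ∀ z : ℝ, 0 < z →
      Tendsto (fun t : ℝ => t * P.real {ω | (b t : ℝ) * z < (X ω : ℝ)}) atTop (𝓝 (z ^ (-α))))
    {B : Set ℝ≥0} (hB : B ∈ cellFamily) :
    Tendsto (fun u : ℝ => P ((fun ω => (b u)⁻¹ * X ω) ⁻¹' B)) atTop
      (𝓝 (B.indicator 1 0)) := by
  rcases hB with rfl | ⟨c, hc, rfl⟩ | ⟨a, c, ha, rfl⟩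
  · simp
  · rw [indicator_of_mem (mem_Iic.2 hc.le)]
    have h := ENNReal.Tendsto.sub (tendsto_const_nhds (x := (1 : ℝ≥0∞)))
      (tendsto_prob_Ioi hα hbpos hb hc) (Or.inl ENNReal.one_ne_top)
    rw [tsub_zero] at h
    refine h.congr fun u => ?_
    rw [← compl_Ioi, preimage_compl,
      prob_compl_eq_one_sub ((hX.const_mul _) measurableSet_Ioi)]
  · rw [indicator_of_notMem (by simp)]
    refine tendsto_of_tendsto_of_tendsto_of_le_of_le tendsto_const_nhds
      (tendsto_prob_Ioi hα hbpos hb ha) (fun _ => zero_le) fun u => ?_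
    exact measure_mono (preimage_mono Ioc_subset_Ioi_self)

/-- If `s / u → ∞` and `s, u → ∞`, then `b s / b u → ∞`. -/
theorem tendsto_scaling_ratio (hbpos : ∀ t, 0 < t → 0 < b t)
    (hb : ∀ z : ℝ, 0 < z →
      Tendsto (fun t : ℝ => t * P.real {ω | (b t : ℝ) * z < (X ω : ℝ)}) atTop (𝓝 (z ^ (-α))))
    {ι : Type*} {l : Filter ι} {s u : ι → ℝ} (hs : Tendsto s l atTop) (hu : Tendsto u l atTop)
    (hsu : Tendsto (fun t => s t / u t) l atTop) :
    Tendsto (fun t => b (s t) / b (u t)) l atTop := by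
  refine tendsto_atTop.2 fun K₀ => ?_
  obtain ⟨K, hK, hKpos⟩ : ∃ K : ℝ≥0, K₀ ≤ K ∧ 0 < K := ⟨K₀ + 1, by simp, by positivity⟩
  have h1 := (hb 1 one_pos).comp hs
  have h2 := (hb K hKpos).comp hu
  have h3 := hsu.atTop_mul_pos (Real.rpow_pos_of_pos hKpos (-α)) h2
  rw [Real.one_rpow] at h1
  filter_upwards [h1.eventually_lt_const one_lt_two, h3.eventually_ge_atTop 2,
    hs.eventually_gt_atTop 0, hu.eventually_gt_atTop 0] with t ht1 ht3 hst hut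
  refine hK.trans ?_
  -- If `b (s t) < K * b (u t)`, then `s t * P(X > b (s t))`, which is eventually below `2`,
  -- dominates `(s t / u t) * (u t * P(X > K * b (u t)))`, which tends to infinity.
  by_contra hlt
  rw [not_le, div_lt_iff₀ (hbpos _ hut)] at hlt
  have hlt' : (b (s t) : ℝ) < K * b (u t) := by exact_mod_cast hlt
  simp only [Function.comp_apply, mul_one] at ht1 ht3
  rw [← mul_assoc, div_mul_cancel₀ _ hut.ne'] at ht3
  have hmono : P.real {ω | (b (u t) : ℝ) * K < X ω} ≤ P.real {ω | (b (s t) : ℝ) < X ω} :=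
    measureReal_mono fun ω hω => by
      have h : (b (u t) : ℝ) * K < X ω := hω
      exact lt_trans (by linarith) h
  have := mul_le_mul_of_nonneg_left hmono hst.le
  linarith

end Tail

/-! ### Cylinders, and the limit measure on them -/

namespace RZ

/-- The sequences `x` with `x l ∈ C l` for all `l ∈ s`. -/
def cyl (s : Finset ℤ) (C : ℤ → Set ℝ≥0) : Set RZ := {x | ∀ l ∈ s, x l ∈ C l}

theorem measurableSet_cyl (s : Finset ℤ) {C : ℤ → Set ℝ≥0} (hC : ∀ l, MeasurableSet (C l)) :
    MeasurableSet (cyl s C) := by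
  have h : cyl s C = ⋂ l ∈ s, (fun x : RZ => x l) ⁻¹' C l := by
    ext x
    simp [cyl]
  rw [h]
  exact s.measurableSet_biInter fun l _ => measurable_coord l (hC l)

/-- The cylinders over products of cells. -/
def cellCylinders : Set (Set RZ) :=
  squareCylinders (α := fun _ : ℤ => ℝ≥0) fun _ => cellFamily

theorem mem_cellCylinders {S : Set RZ} :
    S ∈ cellCylinders ↔ ∃ (s : Finset ℤ) (B : ℤ → Set ℝ≥0),
      (∀ l, B l ∈ cellFamily) ∧ S = cyl s B := by
  constructor
  · rintro ⟨s, B, hB, rfl⟩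
    exact ⟨s, B, fun l => hB l trivial, rfl⟩
  · rintro ⟨s, B, hB, rfl⟩
    exact ⟨s, B, fun l _ => hB l, rfl⟩

theorem isPiSystem_cellCylinders : IsPiSystem cellCylinders :=
  isPiSystem_squareCylinders (α := fun _ : ℤ => ℝ≥0) (fun _ => isPiSystem_cellFamily)
    fun _ => Or.inl rfl

theorem univ_mem_cellCylinders : univ ∈ cellCylinders :=
  mem_cellCylinders.2 ⟨∅, fun _ => univ, fun _ => Or.inl rfl, by simp [cyl]⟩

theorem measurableSet_of_mem_cellCylinders {S : Set RZ} (hS : S ∈ cellCylinders) :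
    MeasurableSet S := by
  obtain ⟨s, B, hB, rfl⟩ := mem_cellCylinders.1 hS
  exact measurableSet_cyl s fun l => measurableSet_of_mem_cellFamily (hB l)

theorem exists_cellCylinders_nhds {U : Set RZ} (hU : IsOpen U) {x : RZ} (hx : x ∈ U) :
    ∃ s ∈ cellCylinders, s ∈ 𝓝 x ∧ s ⊆ U := by
  obtain ⟨J, t, ht, htU⟩ := mem_nhds_of_coord (hU.mem_nhds hx)
  choose B hB hBx hBt using fun i => exists_cellFamily_nhds (ht i)
  refine ⟨cyl J B, mem_cellCylinders.2 ⟨J, B, hB, rfl⟩, ?_,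
    fun y hy => htU fun i hi => hBt i (hy i hi)⟩
  have h : cyl J B = ⋂ i ∈ J, (fun y : RZ => y i) ⁻¹' B i := by
    ext y
    simp [cyl]
  rw [h, Filter.biInter_finset_mem]
  exact fun i _ => (continuous_coord i).continuousAt.preimage_mem_nhds (hBx i)

/-- The sequences whose components at the places `i k` are larger than `ε`. -/
def largeAt {n : ℕ} (i : Fin n ↪o ℤ) (ε : ℝ≥0) : Set RZ := {x | ∀ k, ε < x (i k)}

theorem isOpen_largeAt {n : ℕ} (i : Fin n ↪o ℤ) (ε : ℝ≥0) : IsOpen (largeAt i ε) := by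
  have h : largeAt i ε = ⋂ k, {x : RZ | ε < x (i k)} := by
    ext x
    simp [largeAt]
  rw [h]
  exact isOpen_iInter_of_finite fun k => isOpen_lt continuous_const (continuous_coord (i k))

/-- Places of `i` outside `s` carry no condition from the cylinder, so `B'` is reset to `univ` off
`s` before `s` is enlarged. -/
theorem cyl_inter_largeAt {n : ℕ} (i : Fin n ↪o ℤ) (ε : ℝ≥0) (s : Finset ℤ)
    (B : ℤ → Set ℝ≥0) :
    ∃ B' : ℤ → Set ℝ≥0, (∀ l, B' l = B l ∨ B' l = univ) ∧
      cyl s B ∩ largeAt i ε = cyl (s ∪ Finset.univ.map i.toEmbedding)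
          fun l => if l ∈ Finset.univ.map i.toEmbedding then B' l ∩ Ioi ε else B' l := by
  classical
  refine ⟨fun l => if l ∈ s then B l else univ, fun l => ?_, ?_⟩
  · by_cases hl : l ∈ s <;> simp [hl]
  · ext x
    simp only [cyl, largeAt, mem_inter_iff, mem_ofPred_eq, Finset.mem_union]
    constructor
    · rintro ⟨h1, h2⟩ l -
      by_cases hl : l ∈ Finset.univ.map i.toEmbedding
      · obtain ⟨k, -, rfl⟩ := Finset.mem_map.1 hl
        rw [if_pos hl]
        refine ⟨?_, h2 k⟩
        split_ifs with hs
        · exact h1 _ hs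
        · trivial
      · rw [if_neg hl]
        split_ifs with hs
        · exact h1 _ hs
        · trivial
    · intro h
      refine ⟨fun l hl => ?_, fun k => ?_⟩
      · have h1 := h l (Or.inl hl)
        rw [if_pos hl] at h1
        split_ifs at h1
        · exact h1.1
        · exact h1
      · have hR : i k ∈ Finset.univ.map i.toEmbedding :=
          Finset.mem_map_of_mem i.toEmbedding (Finset.mem_univ k)
        have h1 := h (i k) (Or.inr hR)
        rw [if_pos hR] at h1
        exact h1.2

/-- The limit measure at the places `i` of a cylinder. -/
theorem map_comb_cyl {α : ℝ} (hα : 0 < α) {n : ℕ} (i : Fin n ↪o ℤ) {s : Finset ℤ}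
    (hs : Finset.univ.map i.toEmbedding ⊆ s) {C : ℤ → Set ℝ≥0} (hC : ∀ l, MeasurableSet (C l)) :
    ((Measure.pi fun _ : Fin n => nuAlpha α).map (comb i)) (cyl s C) =
      ∏ l ∈ s, if l ∈ Finset.univ.map i.toEmbedding then nuAlpha α (C l)
        else (C l).indicator 1 0 := by
  have := nuAlpha_sigmaFinite hα
  rw [Measure.map_apply (measurable_comb i) (measurableSet_cyl s hC),
    ← Finset.prod_sdiff hs]
  have hR : (∏ l ∈ Finset.univ.map i.toEmbedding,
      if l ∈ Finset.univ.map i.toEmbedding then nuAlpha α (C l) else (C l).indicator 1 0) =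
        ∏ k, nuAlpha α (C (i k)) := by
    rw [Finset.prod_congr rfl fun l hl => if_pos hl, Finset.prod_map]
    rfl
  have hD : (∏ l ∈ s \ Finset.univ.map i.toEmbedding,
      if l ∈ Finset.univ.map i.toEmbedding then nuAlpha α (C l) else (C l).indicator 1 0) =
        ∏ l ∈ s \ Finset.univ.map i.toEmbedding, ((C l).indicator 1 0 : ℝ≥0∞) :=
    Finset.prod_congr rfl fun l hl => if_neg (Finset.mem_sdiff.1 hl).2
  have hout : ∀ l ∈ s \ Finset.univ.map i.toEmbedding, l ∉ range i := fun l hl ⟨k, hk⟩ =>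
    (Finset.mem_sdiff.1 hl).2 (hk ▸ Finset.mem_map_of_mem i.toEmbedding (Finset.mem_univ k))
  rw [hR, hD]
  -- Off the range of `i` every `comb i z` vanishes: either all those constraints allow `0` and a
  -- product set remains, or the preimage is empty.
  by_cases h0 : ∀ l ∈ s \ Finset.univ.map i.toEmbedding, (0 : ℝ≥0) ∈ C l
  · rw [Finset.prod_eq_one fun l hl => indicator_of_mem (h0 l hl) _, one_mul, ← Measure.pi_pi]
    congr 1
    ext z
    constructor
    · intro hz k _
      have h := hz (i k) (hs (Finset.mem_map_of_mem i.toEmbedding (Finset.mem_univ k)))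
      rwa [comb_apply] at h
    · intro hz l hl
      by_cases hlR : l ∈ range i
      · obtain ⟨k, rfl⟩ := hlR
        rw [comb_apply]
        exact hz k trivial
      · rw [comb_of_notMem i z hlR]
        refine h0 l (Finset.mem_sdiff.2 ⟨hl, fun hl' => hlR ?_⟩)
        obtain ⟨k, -, hk⟩ := Finset.mem_map.1 hl'
        exact ⟨k, hk⟩
  · push Not at h0
    obtain ⟨l, hl, hl0⟩ := h0
    rw [Finset.prod_eq_zero hl (indicator_of_notMem hl0 _), zero_mul]
    convert measure_empty (μ := Measure.pi fun _ : Fin n => nuAlpha α)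
    refine eq_empty_of_forall_notMem fun z hz => hl0 ?_
    have h := hz l (Finset.mem_sdiff.1 hl).1
    rwa [comb_of_notMem i z (hout l hl)] at h

theorem map_comb_largeAt {α : ℝ} (hα : 0 < α) {n : ℕ} (i : Fin n ↪o ℤ) (ε : ℝ≥0) :
    ((Measure.pi fun _ : Fin n => nuAlpha α).map (comb i)) (largeAt i ε) =
      nuAlpha α (Ioi ε) ^ n := by
  have := nuAlpha_sigmaFinite hα
  rw [Measure.map_apply (measurable_comb i) (isOpen_largeAt i ε).measurableSet]
  have h : comb i ⁻¹' largeAt i ε = univ.pi fun _ => Ioi ε := by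
    ext z
    simp [largeAt, comb_apply]
  rw [h, Measure.pi_pi]
  simp

end RZ

/-! ### Scaled laws on cylinders and their weak limits -/

instance scaledLaw_isFiniteMeasure {Ω : Type*} [MeasurableSpace Ω] (P : Measure Ω)
    [IsProbabilityMeasure P] (b : ℝ → ℝ≥0) (Y : ℤ → Ω → ℝ≥0) (j : ℕ) (t : ℝ) :
    IsFiniteMeasure (scaledLaw P b Y j t) :=
  Measure.smul_finite _ ENNReal.ofReal_ne_top

section ScaledLaw

variable {Ω : Type*} [MeasurableSpace Ω] {P : Measure Ω} {α : ℝ} {Z : ℤ → Ω → ℝ≥0} {b : ℝ → ℝ≥0}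

theorem measurable_scale_seqOf (hZ : ∀ i, Measurable (Z i)) (c : ℝ≥0) :
    Measurable fun ω => RZ.scale c (seqOf Z ω) :=
  RZ.measurable_of_coord fun l => (hZ l).const_mul c

/-- The scaled law of an i.i.d. sequence on a cylinder. -/
theorem scaledLaw_cyl (hZ : ∀ i, Measurable (Z i)) (hindep : iIndepFun Z P)
    (hident : ∀ i, IdentDistrib (Z i) (Z 0) P P) {j : ℕ} {t : ℝ} (ht : 0 < t)
    (i : Fin (j + 1) ↪o ℤ) {s : Finset ℤ} (hs : Finset.univ.map i.toEmbedding ⊆ s)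
    {C : ℤ → Set ℝ≥0} (hC : ∀ l, MeasurableSet (C l)) :
    scaledLaw P b Z j t (RZ.cyl s C) =
      ∏ l ∈ s, if l ∈ Finset.univ.map i.toEmbedding then
          ENNReal.ofReal (t ^ (1 / ((j : ℝ) + 1))) *
            P ((fun ω => (scaling b j t)⁻¹ * Z 0 ω) ⁻¹' C l)
        else P ((fun ω => (scaling b j t)⁻¹ * Z 0 ω) ⁻¹' C l) := by
  set c := (scaling b j t)⁻¹
  have hCm : ∀ l, MeasurableSet ((fun x : ℝ≥0 => c * x) ⁻¹' C l) := fun l =>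
    (measurable_id.const_mul c) (hC l)
  have hpre : (fun ω => RZ.scale c (seqOf Z ω)) ⁻¹' (RZ.cyl s C) =
      ⋂ l ∈ s, Z l ⁻¹' ((fun x : ℝ≥0 => c * x) ⁻¹' C l) := by
    ext ω
    simp only [mem_iInter]
    rfl
  have hprod : P (⋂ l ∈ s, Z l ⁻¹' ((fun x : ℝ≥0 => c * x) ⁻¹' C l)) =
      ∏ l ∈ s, P ((fun ω => c * Z 0 ω) ⁻¹' C l) := by
    rw [hindep.measure_inter_preimage_eq_mul s fun l _ => hCm l]
    exact Finset.prod_congr rfl fun l _ => (hident l).measure_preimage_eq (hCm l)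
  -- The mass factor `t` is spread as one root `t ^ (1 / (j + 1))` over each of the `j + 1` places
  -- of `i`.
  have hpow : (∏ l ∈ s, if l ∈ Finset.univ.map i.toEmbedding then
      ENNReal.ofReal (t ^ (1 / ((j : ℝ) + 1))) else 1) = ENNReal.ofReal t := by
    rw [Finset.prod_ite_mem, Finset.inter_eq_right.2 hs, Finset.prod_const, Finset.card_map,
      Finset.card_univ, Fintype.card_fin, ← ENNReal.ofReal_pow (by positivity),
      ← Real.rpow_natCast, ← Real.rpow_mul ht.le]
    congr 1
    push_cast
    rw [one_div_mul_cancel (by positivity), Real.rpow_one]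
  rw [scaledLaw, Measure.smul_apply, smul_eq_mul,
    Measure.map_apply (measurable_scale_seqOf hZ c) (RZ.measurableSet_cyl s hC), hpre,
    hprod, ← hpow, ← Finset.prod_mul_distrib]
  refine Finset.prod_congr rfl fun l _ => ?_
  split_ifs <;> simp

theorem tendsto_time_root (j : ℕ) : Tendsto (fun t : ℝ => t ^ (1 / ((j : ℝ) + 1))) atTop atTop :=
  tendsto_rpow_atTop (by positivity)

/-- Weak convergence of the scaled laws, restricted to the sequences which are large at `j + 1`
given places. -/
theorem tendsto_restrict_largeAt [IsProbabilityMeasure P] (hα : 0 < α) (hZ : ∀ i, Measurable (Z i))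
    (hindep : iIndepFun Z P) (hident : ∀ i, IdentDistrib (Z i) (Z 0) P P)
    (hbpos : ∀ t, 0 < t → 0 < b t)
    (hb : ∀ z : ℝ, 0 < z →
      Tendsto (fun t : ℝ => t * P.real {ω | (b t : ℝ) * z < (Z 0 ω : ℝ)}) atTop (𝓝 (z ^ (-α))))
    {j : ℕ} (i : Fin (j + 1) ↪o ℤ) {ε : ℝ≥0} (hε : 0 < ε) (g : RZ →ᵇ ℝ≥0) :
    Tendsto (fun t : ℝ => ∫⁻ x in RZ.largeAt i ε, g x ∂(scaledLaw P b Z j t)) atTop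
      (𝓝 (∫⁻ x in RZ.largeAt i ε, g x
        ∂((Measure.pi fun _ : Fin (j + 1) => nuAlpha α).map (RZ.comb i)))) := by
  set ν := (Measure.pi fun _ : Fin (j + 1) => nuAlpha α).map (RZ.comb i) with hνdef
  have hνF : ν (RZ.largeAt i ε) = ENNReal.ofReal ((ε : ℝ) ^ (-α)) ^ (j + 1) := by
    rw [hνdef, RZ.map_comb_largeAt hα, nuAlpha_Ioi hα hε]
  have hνfin : IsFiniteMeasure (ν.restrict (RZ.largeAt i ε)) := by
    refine ⟨?_⟩
    rw [Measure.restrict_apply_univ, hνF]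
    exact ENNReal.pow_lt_top ENNReal.ofReal_lt_top
  let M : ℝ → FiniteMeasure RZ := fun t =>
    ⟨(scaledLaw P b Z j t).restrict (RZ.largeAt i ε), inferInstance⟩
  let N : FiniteMeasure RZ := ⟨ν.restrict (RZ.largeAt i ε), hνfin⟩
  have hN : N ≠ 0 := by
    intro h
    have h1 : (N : Measure RZ) univ = 0 := by
      rw [h]
      rfl
    have h2 : (N : Measure RZ) univ = ENNReal.ofReal ((ε : ℝ) ^ (-α)) ^ (j + 1) := by
      rw [← hνF]
      exact Measure.restrict_apply_univ _
    rw [h1] at h2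
    refine (pow_ne_zero (j + 1) ?_) h2.symm
    exact (ENNReal.ofReal_pos.2 (Real.rpow_pos_of_pos hε _)).ne'
  suffices h : Tendsto M atTop (𝓝 N) from
    FiniteMeasure.tendsto_iff_forall_lintegral_tendsto.1 h g
  refine RZ.isPiSystem_cellCylinders.tendsto_finiteMeasure_of_tendsto_of_mem
    RZ.univ_mem_cellCylinders (fun s hs => RZ.measurableSet_of_mem_cellCylinders hs)
    (fun u hu x hx => RZ.exists_cellCylinders_nhds hu hx) ?_ hN
  intro S hS
  have hSm := RZ.measurableSet_of_mem_cellCylinders hS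
  obtain ⟨s, B, hB, rfl⟩ := RZ.mem_cellCylinders.1 hS
  refine (ENNReal.tendsto_toNNReal_iff (measure_ne_top _ _) fun t => measure_ne_top _ _).2 ?_
  obtain ⟨B', hB', hinter⟩ := RZ.cyl_inter_largeAt i ε s B
  have hB'mem : ∀ l, B' l ∈ cellFamily := fun l => by
    rcases hB' l with h | h <;> rw [h]
    · exact hB l
    · exact Or.inl rfl
  have hB'm : ∀ l, MeasurableSet (B' l) := fun l =>
    measurableSet_of_mem_cellFamily (hB'mem l)
  have hCm : ∀ l, MeasurableSet
      (if l ∈ Finset.univ.map i.toEmbedding then B' l ∩ Ioi ε else B' l) := fun l => by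
    split_ifs
    · exact (hB'm l).inter measurableSet_Ioi
    · exact hB'm l
  have hNS : (N : Measure RZ) (RZ.cyl s B) =
      ∏ l ∈ s ∪ Finset.univ.map i.toEmbedding, if l ∈ Finset.univ.map i.toEmbedding then
        nuAlpha α (B' l ∩ Ioi ε) else (B' l).indicator 1 0 := by
    refine (Measure.restrict_apply hSm).trans ?_
    refine (congrArg ν hinter).trans ?_
    rw [hνdef, RZ.map_comb_cyl hα i Finset.subset_union_right hCm]
    refine Finset.prod_congr rfl fun l _ => ?_
    split_ifs <;> rfl
  have hMS : ∀ t, 0 < t → (M t : Measure RZ) (RZ.cyl s B) =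
      ∏ l ∈ s ∪ Finset.univ.map i.toEmbedding, if l ∈ Finset.univ.map i.toEmbedding then
        ENNReal.ofReal (t ^ (1 / ((j : ℝ) + 1))) *
          P ((fun ω => (scaling b j t)⁻¹ * Z 0 ω) ⁻¹' (B' l ∩ Ioi ε))
        else P ((fun ω => (scaling b j t)⁻¹ * Z 0 ω) ⁻¹' B' l) := fun t ht => by
    refine (Measure.restrict_apply hSm).trans ?_
    refine (congrArg (scaledLaw P b Z j t) hinter).trans ?_
    rw [scaledLaw_cyl hZ hindep hident ht i Finset.subset_union_right hCm]
    refine Finset.prod_congr rfl fun l _ => ?_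
    split_ifs <;> rfl
  rw [hNS]
  have key : Tendsto (fun t : ℝ => ∏ l ∈ s ∪ Finset.univ.map i.toEmbedding,
      if l ∈ Finset.univ.map i.toEmbedding then
        ENNReal.ofReal (t ^ (1 / ((j : ℝ) + 1))) *
          P ((fun ω => (scaling b j t)⁻¹ * Z 0 ω) ⁻¹' (B' l ∩ Ioi ε))
        else P ((fun ω => (scaling b j t)⁻¹ * Z 0 ω) ⁻¹' B' l)) atTop
      (𝓝 (∏ l ∈ s ∪ Finset.univ.map i.toEmbedding, if l ∈ Finset.univ.map i.toEmbedding then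
        nuAlpha α (B' l ∩ Ioi ε) else (B' l).indicator 1 0)) := by
    refine ENNReal.tendsto_finsetProd_of_ne_top _ (fun l _ => ?_) fun l _ => ?_
    · by_cases hl : l ∈ Finset.univ.map i.toEmbedding
      · simp only [hl, if_true]
        exact (tendsto_tail_cell hα (hZ 0) hbpos hb hε (hB'mem l)).comp (tendsto_time_root j)
      · simp only [hl, if_false]
        exact (tendsto_prob_cell hα (hZ 0) hbpos hb (hB'mem l)).comp (tendsto_time_root j)
    · split_ifs
      · refine ne_top_of_le_ne_top ?_ (measure_mono inter_subset_right)
        rw [nuAlpha_Ioi hα hε]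
        exact ENNReal.ofReal_ne_top
      · by_cases h0 : (0 : ℝ≥0) ∈ B' l <;> simp [h0]
  refine key.congr' ?_
  filter_upwards [eventually_gt_atTop 0] with t ht
  exact (hMS t ht).symm

end ScaledLaw

/-! ### Localisation to given large places -/

namespace RZ

theorem isOpen_largeSet (j : ℕ) (J : Finset ℤ) (ε : ℝ≥0) : IsOpen (largeSet j J ε) := by
  have h : largeSet j J ε =
      ⋃ (i : Fin (j + 1) ↪o ℤ) (_ : ∀ k, i k ∈ J), largeAt i ε := by
    ext x
    simp [largeSet, largeAt]
  rw [h]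
  exact isOpen_iUnion fun i => isOpen_iUnion fun _ => isOpen_largeAt i ε

/-- Only the finitely many lists inside `J` contribute, since `comb i z` can be large at `j + 1`
places only along `i`. Each of them contributes at most `nuAlpha α (Ioi ε) ^ (j + 1)`. -/
theorem muLim_largeSet_lt_top {α : ℝ} (hα : 0 < α) (j : ℕ) (J : Finset ℤ) {ε : ℝ≥0}
    (hε : 0 < ε) : muLim α j (largeSet j J ε) < ∞ := by
  rw [muLim, Measure.sum_apply _ (isOpen_largeSet j J ε).measurableSet,
    tsum_eq_sum (s := (finite_orderEmbedding_into (j + 1) J).toFinset)]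
  · refine ENNReal.sum_lt_top.2 fun i _ => ?_
    have hle : ((Measure.pi fun _ : Fin (j + 1) => nuAlpha α).map (comb i)) (largeSet j J ε) ≤
        ((Measure.pi fun _ : Fin (j + 1) => nuAlpha α).map (comb i)) (largeAt i ε) := by
      rw [Measure.map_apply (measurable_comb i) (isOpen_largeSet j J ε).measurableSet,
        Measure.map_apply (measurable_comb i) (isOpen_largeAt i ε).measurableSet]
      refine measure_mono ?_
      rintro z ⟨i', -, hi'⟩
      rwa [eq_of_comb_pos fun k => lt_of_le_of_lt zero_le (hi' k)] at hi'
    refine hle.trans_lt ?_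
    rw [map_comb_largeAt hα, nuAlpha_Ioi hα hε]
    exact ENNReal.pow_lt_top ENNReal.ofReal_lt_top
  · intro i hi
    rw [Measure.map_apply (measurable_comb i) (isOpen_largeSet j J ε).measurableSet]
    convert measure_empty (μ := Measure.pi fun _ : Fin (j + 1) => nuAlpha α)
    refine eq_empty_of_forall_notMem ?_
    rintro z ⟨i', hi'J, hi'⟩
    rw [eq_of_comb_pos fun k => lt_of_le_of_lt zero_le (hi' k)] at hi'J
    exact hi (by simpa using hi'J)

/-- A function which is bounded, continuous and supported in the sequences with at least `j + 1`
large components in a window is a finite sum of such functions supported in the sequences with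
large components at `j + 1` given places. -/
theorem exists_decomposition {j : ℕ} {J : Finset ℤ} {ε : ℝ≥0} (hε : 0 < ε) (g : RZ →ᵇ ℝ≥0)
    (hg : ∀ x ∉ largeSet j J ε, g x = 0) :
    ∃ (δ : ℝ≥0) (S : Finset (Fin (j + 1) ↪o ℤ)) (G : (Fin (j + 1) ↪o ℤ) → RZ →ᵇ ℝ≥0), 0 < δ ∧
      (∀ i, ∀ x ∉ largeAt i δ, G i x = 0) ∧ ∀ x, g x = ∑ i ∈ S, G i x := by
  classical
  let δ : ℝ≥0 := ε / 2
  have hδ : 0 < δ := half_pos hε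
  let S : Finset (Fin (j + 1) ↪o ℤ) := (finite_orderEmbedding_into (j + 1) J).toFinset
  -- Truncated subtraction makes the weight `w i` vanish off `largeAt i δ`. Where some list in `J`
  -- exceeds `ε = 2 * δ`, its weight is at least `δ ^ (j + 1)`, so the maximum with this constant
  -- keeps the denominator positive without changing it on the support of `g`.
  let w : (Fin (j + 1) ↪o ℤ) → RZ → ℝ≥0 := fun i x => ∏ k, (x (i k) - δ)
  let W : RZ → ℝ≥0 := fun x => ∑ i ∈ S, w i x
  have hw : ∀ i, Continuous (w i) := fun i =>
    continuous_finsetProd _ fun k _ => (continuous_coord (i k)).sub continuous_const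
  have hW : Continuous W := continuous_finsetSum _ fun i _ => hw i
  have hc : ∀ x, max (W x) (δ ^ (j + 1)) ≠ 0 := fun x =>
    (lt_max_of_lt_right (pow_pos hδ _)).ne'
  let q : (Fin (j + 1) ↪o ℤ) → RZ → ℝ≥0 := fun i x =>
    if i ∈ S then g x * (w i x / max (W x) (δ ^ (j + 1))) else 0
  have hq : ∀ i, Continuous (q i) := fun i => by
    by_cases hi : i ∈ S
    · simp only [q, hi, if_true]
      exact g.continuous.mul ((hw i).div (hW.max continuous_const) hc)
    · simp only [q, hi, if_false]
      exact continuous_const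
  have hqb : ∀ i x, q i x ≤ nndist g 0 := fun i x => by
    by_cases hi : i ∈ S
    · simp only [q, hi, if_true]
      refine (mul_le_of_le_one_right zero_le (div_le_one_of_le₀ ?_ zero_le)).trans
        (BoundedContinuousFunction.NNReal.upper_bound g x)
      exact (Finset.single_le_sum (f := fun i => w i x) (fun _ _ => zero_le) hi).trans
        (le_max_left _ _)
    · simp only [q, hi, if_false]
      exact zero_le
  let G : (Fin (j + 1) ↪o ℤ) → RZ →ᵇ ℝ≥0 := fun i =>
    BoundedContinuousFunction.mkOfBound ⟨q i, hq i⟩ (nndist g 0) fun x y => by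
      rw [NNReal.dist_eq, abs_le]
      have h1 : (q i x : ℝ) ≤ nndist g 0 := by exact_mod_cast hqb i x
      have h2 : (q i y : ℝ) ≤ nndist g 0 := by exact_mod_cast hqb i y
      have h3 := (q i x).coe_nonneg
      have h4 := (q i y).coe_nonneg
      constructor
      · show -((nndist g 0 : ℝ≥0) : ℝ) ≤ (q i x : ℝ) - q i y
        linarith
      · show (q i x : ℝ) - q i y ≤ ((nndist g 0 : ℝ≥0) : ℝ)
        linarith
  have hG : ∀ i x, G i x = q i x := fun i x => rfl
  refine ⟨δ, S, G, hδ, fun i x hx => ?_, fun x => ?_⟩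
  · obtain ⟨k, hk⟩ : ∃ k, x (i k) ≤ δ := by
      by_contra h
      push Not at h
      exact hx h
    have hwi : w i x = 0 := Finset.prod_eq_zero (Finset.mem_univ k) (tsub_eq_zero_of_le hk)
    rw [hG]
    simp [q, hwi]
  · have hsum : ∑ i ∈ S, G i x = g x * (W x / max (W x) (δ ^ (j + 1))) := by
      rw [Finset.sum_div, Finset.mul_sum]
      refine Finset.sum_congr rfl fun i hi => ?_
      rw [hG]
      simp only [q, hi, if_true]
    rw [hsum]
    by_cases hx : x ∈ largeSet j J ε
    · obtain ⟨i, hiJ, hi⟩ := hx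
      have h1 : δ ^ (j + 1) ≤ w i x := by
        have h2 : ∏ _k : Fin (j + 1), δ ≤ w i x := Finset.prod_le_prod' fun k _ => by
          refine le_tsub_of_add_le_right ?_
          rw [add_halves]
          exact (hi k).le
        simpa using h2
      have h2 : w i x ≤ W x := Finset.single_le_sum (f := fun i => w i x) (fun _ _ => zero_le)
        (by simpa [S] using hiJ)
      have h3 : max (W x) (δ ^ (j + 1)) = W x := max_eq_left (h1.trans h2)
      rw [h3, div_self (h3 ▸ hc x), mul_one]
    · rw [hg x hx, zero_mul]

/-- The summands of `muLim` for other lists `i'` give no mass to `largeAt i δ`, by `eq_of_comb_pos`.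
-/
theorem lintegral_muLim_of_support {α : ℝ} {j : ℕ} {i : Fin (j + 1) ↪o ℤ} {δ : ℝ≥0}
    (G : RZ →ᵇ ℝ≥0) (hG : ∀ x ∉ largeAt i δ, G x = 0) :
    ∫⁻ x, G x ∂(muLim α j) =
      ∫⁻ x in largeAt i δ, G x
        ∂((Measure.pi fun _ : Fin (j + 1) => nuAlpha α).map (comb i)) := by
  have hmeas : Measurable fun x => (G x : ℝ≥0∞) := G.continuous.measurable.coe_nnreal_ennreal
  rw [muLim, lintegral_sum_measure, tsum_eq_single i]
  · rw [← lintegral_indicator (isOpen_largeAt i δ).measurableSet]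
    congr 1
    refine (indicator_eq_self.2 fun x hx => ?_).symm
    by_contra hx'
    exact hx (by simp [hG x hx'])
  · intro i' hi'
    rw [lintegral_map hmeas (measurable_comb i')]
    refine (lintegral_congr fun z => ?_).trans lintegral_zero
    rw [hG _ fun hz => hi' (eq_of_comb_pos fun k => lt_of_le_of_lt zero_le (hz k)).symm]
    rfl

end RZ

/-- Convergence of the integrals of the functions supported in the sequences with at least `j + 1`
large components in a window. -/
theorem tendsto_lintegral_scaledLaw {Ω : Type*} [MeasurableSpace Ω] {P : Measure Ω}
    [IsProbabilityMeasure P] {α : ℝ} {Z : ℤ → Ω → ℝ≥0} {b : ℝ → ℝ≥0} (hα : 0 < α)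
    (hZ : ∀ i, Measurable (Z i))
    (hindep : iIndepFun Z P) (hident : ∀ i, IdentDistrib (Z i) (Z 0) P P)
    (hbpos : ∀ t, 0 < t → 0 < b t)
    (hb : ∀ z : ℝ, 0 < z →
      Tendsto (fun t : ℝ => t * P.real {ω | (b t : ℝ) * z < (Z 0 ω : ℝ)}) atTop (𝓝 (z ^ (-α))))
    {j : ℕ} {J : Finset ℤ} {ε : ℝ≥0} (hε : 0 < ε) (g : RZ →ᵇ ℝ≥0)
    (hg : ∀ x ∉ RZ.largeSet j J ε, g x = 0) :
    Tendsto (fun t : ℝ => ∫⁻ x, g x ∂(scaledLaw P b Z j t)) atTop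
      (𝓝 (∫⁻ x, g x ∂(muLim α j))) := by
  obtain ⟨δ, S, G, hδ, hGs, hG⟩ := RZ.exists_decomposition hε g hg
  have hmeas : ∀ i, Measurable fun x => (G i x : ℝ≥0∞) := fun i =>
    (G i).continuous.measurable.coe_nnreal_ennreal
  have hsum : ∀ μ : Measure RZ, ∫⁻ x, g x ∂μ = ∑ i ∈ S, ∫⁻ x, G i x ∂μ := fun μ => by
    rw [← lintegral_finsetSum _ fun i _ => hmeas i]
    refine lintegral_congr fun x => ?_
    rw [hG x]
    push_cast
    rfl
  simp only [hsum]
  refine tendsto_finsetSum _ fun i _ => ?_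
  rw [RZ.lintegral_muLim_of_support (G i) (hGs i)]
  refine (tendsto_restrict_largeAt hα hZ hindep hident hbpos hb i hδ (G i)).congr fun t => ?_
  rw [← lintegral_indicator (RZ.isOpen_largeAt i δ).measurableSet]
  congr 1
  refine indicator_eq_self.2 fun x hx => ?_
  by_contra hx'
  exact hx (by simp [hGs i x hx'])

/-! ### Test functions and convergence in `MO C` -/

/-- A test function extends by zero to a bounded continuous function. -/
theorem TestFun.exists_extension {S : Type*} [PseudoMetricSpace S] {C : Set S} (hC : IsClosed C)
    (f : TestFun C) : ∃ (F : S →ᵇ ℝ≥0) (r : ℝ), 0 < r ∧ (∀ x : (Cᶜ : Set S), F x = f.1 x) ∧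
      ∀ x ∈ Metric.thickening r C, F x = 0 := by
  classical
  obtain ⟨f, r, hr, hf⟩ := f
  let F : S → ℝ≥0 := fun x => if h : x ∈ Cᶜ then f ⟨x, h⟩ else 0
  have hF : ∀ x : (Cᶜ : Set S), F x = f x := fun x => dif_pos x.2
  have hF0 : ∀ x ∈ Metric.thickening r C, F x = 0 := fun x hx => by
    by_cases h : x ∈ Cᶜ
    · exact (dif_pos h).trans (hf ⟨x, h⟩ hx)
    · exact dif_neg h
  have hcont : Continuous F := by
    -- Off `C` continuity is inherited through the open embedding; at a point of `C` the extension
    -- vanishes on the whole thickening, a neighbourhood of that point.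
    refine continuous_iff_continuousAt.2 fun x => ?_
    by_cases h : x ∈ Cᶜ
    · have h1 : ContinuousAt (F ∘ Subtype.val) (⟨x, h⟩ : (Cᶜ : Set S)) := by
        have h2 : F ∘ Subtype.val = f := funext hF
        rw [h2]
        exact f.continuous.continuousAt
      exact (hC.isOpen_compl.isOpenEmbedding_subtypeVal.continuousAt_iff).1 h1
    · have hx : x ∈ Metric.thickening r C :=
        Metric.self_subset_thickening hr C (not_not.1 h)
      refine ContinuousAt.congr (f := fun _ => (0 : ℝ≥0)) continuousAt_const ?_
      filter_upwards [Metric.isOpen_thickening.mem_nhds hx] with y hy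
      exact (hF0 y hy).symm
  have hbound : ∀ x, F x ≤ nndist f 0 := fun x => by
    by_cases h : x ∈ Cᶜ
    · rw [hF ⟨x, h⟩]
      exact BoundedContinuousFunction.NNReal.upper_bound f _
    · rw [show F x = 0 from dif_neg h]
      exact zero_le
  refine ⟨BoundedContinuousFunction.mkOfBound ⟨F, hcont⟩ (nndist f 0) fun x y => ?_, r, hr, hF,
    hF0⟩
  have h1 : (F x : ℝ) ≤ nndist f 0 := by exact_mod_cast hbound x
  have h2 : (F y : ℝ) ≤ nndist f 0 := by exact_mod_cast hbound y
  have h3 := (F x).coe_nonneg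
  have h4 := (F y).coe_nonneg
  rw [NNReal.dist_eq, abs_le]
  constructor
  · show -((nndist f 0 : ℝ≥0) : ℝ) ≤ (F x : ℝ) - F y
    linarith
  · show (F x : ℝ) - F y ≤ ((nndist f 0 : ℝ≥0) : ℝ)
    linarith

theorem restrictCompl_apply {S : Type*} [MeasurableSpace S] {C : Set S} (hC : MeasurableSet C)
    (μ : Measure S) (A : Set (Cᶜ : Set S)) : restrictCompl C μ A = μ (Subtype.val '' A) :=
  (MeasurableEmbedding.subtype_coe hC.compl).comap_apply μ A

/-- The integral of a test function against the restriction of a measure, in terms of the extension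
of the test function. -/
theorem integral_restrictCompl {S : Type*} [PseudoMetricSpace S] [MeasurableSpace S]
    [BorelSpace S] {C : Set S} (hC : IsClosed C) (μ : Measure S) {f : (Cᶜ : Set S) →ᵇ ℝ≥0}
    {F : S →ᵇ ℝ≥0} (hF : ∀ x : (Cᶜ : Set S), F x = f x) (hF0 : ∀ x ∈ C, F x = 0) :
    ∫ x, (f x : ℝ) ∂(restrictCompl C μ) = (∫⁻ x, F x ∂μ).toReal := by
  rw [integral_eq_lintegral_of_nonneg_ae (Eventually.of_forall fun x => (f x).coe_nonneg)
    f.continuous.measurable.coe_nnreal_real.aestronglyMeasurable]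
  congr 1
  have h1 : ∀ x, ENNReal.ofReal (f x : ℝ) = (F x : ℝ≥0∞) := fun x => by
    rw [ENNReal.ofReal_coe_nnreal, hF]
  simp only [h1]
  rw [restrictCompl, lintegral_subtype_comap hC.measurableSet.compl fun x => (F x : ℝ≥0∞),
    ← lintegral_indicator hC.measurableSet.compl]
  congr 1
  refine indicator_eq_self.2 fun x hx hxC => ?_
  exact hx (by simp [hF0 x hxC])

/-- Convergence in `M(S \ C)` is convergence of the integrals of all test functions. -/
theorem MO.tendsto_iff {S : Type*} [PseudoMetricSpace S] [MeasurableSpace S] {C : Set S}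
    {ι : Type*} {l : Filter ι} {M : ι → MO C} {N : MO C} :
    Tendsto M l (𝓝 N) ↔ ∀ f : TestFun C,
      Tendsto (fun t => ∫ x, (f.1 x : ℝ) ∂(M t).toMeasure) l
        (𝓝 (∫ x, (f.1 x : ℝ) ∂N.toMeasure)) := by
  rw [nhds_induced, tendsto_comap_iff, tendsto_pi_nhds]
  rfl

/-! ### Transport along the moving average map, and the conclusion -/

theorem map_T_scaledLaw {Ω : Type*} [MeasurableSpace Ω] (P : Measure Ω) (b : ℝ → ℝ≥0)
    {Z : ℤ → Ω → ℝ≥0} (hZ : ∀ i, Measurable (Z i)) (ψ : ℕ → ℝ≥0) (m j : ℕ) (t : ℝ) :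
    (scaledLaw P b Z j t).map (RZ.T ψ m) = scaledLaw P b (maProc ψ m Z) j t := by
  rw [scaledLaw, scaledLaw, Measure.map_smul,
    Measure.map_map (RZ.measurable_T ψ m) (measurable_scale_seqOf hZ _)]
  congr 2
  funext ω
  exact RZ.T_scale ψ m _ _

theorem map_T_muLim (α : ℝ) (ψ : ℕ → ℝ≥0) (m j : ℕ) :
    (muLim α j).map (RZ.T ψ m) = muLimMA α ψ m j := by
  ext A hA
  rw [Measure.map_apply (RZ.measurable_T ψ m) hA, muLim, muLimMA,
    Measure.sum_apply _ (RZ.measurable_T ψ m hA), Measure.sum_apply _ hA]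
  refine tsum_congr fun i => ?_
  rw [Measure.map_apply (RZ.measurable_comb i) (RZ.measurable_T ψ m hA),
    Measure.map_apply (f := fun z => RZ.T ψ m (RZ.comb i z))
      ((RZ.measurable_T ψ m).comp (RZ.measurable_comb i)) hA]
  rfl

/-- A single summand suffices: for the places `0, …, j`, the vectors with all entries above `1` have
positive mass and are sent off the image of `Cle j`. -/
theorem muLim_apply_pos {α : ℝ} (hα : 0 < α) {ψ : ℕ → ℝ≥0} (hψ : 0 < ψ 0) (m j : ℕ) :
    0 < muLim α j (RZ.T ψ m ⁻¹' (RZ.T ψ m '' RZ.Cle j)ᶜ) := by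
  have hmeas : MeasurableSet (RZ.T ψ m ⁻¹' (RZ.T ψ m '' RZ.Cle j)ᶜ) :=
    RZ.measurable_T ψ m (RZ.isClosed_image_T hψ m (RZ.isClosed_Cle j)).measurableSet.compl
  let i : Fin (j + 1) ↪o ℤ := Fin.valOrderEmb (j + 1) |>.trans Nat.castOrderEmbedding
  rw [muLim, Measure.sum_apply _ hmeas]
  refine lt_of_lt_of_le ?_ (ENNReal.le_tsum i)
  have h1 : 0 < ((Measure.pi fun _ : Fin (j + 1) => nuAlpha α).map (RZ.comb i))
      (RZ.largeAt i 1) := by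
    rw [RZ.map_comb_largeAt hα, nuAlpha_Ioi hα one_pos]
    simp
  refine h1.trans_le ?_
  rw [Measure.map_apply (RZ.measurable_comb i) hmeas,
    Measure.map_apply (RZ.measurable_comb i) (RZ.isOpen_largeAt i 1).measurableSet]
  refine measure_mono fun z hz => RZ.T_comb_notMem hψ m i fun k => ?_
  have h2 : (1 : ℝ≥0) < RZ.comb i z (i k) := hz k
  rw [RZ.comb_apply] at h2
  exact one_pos.trans h2

theorem muLim_apply_compl_Cle (α : ℝ) (j : ℕ) : muLim α j (RZ.Cle (j + 1))ᶜ = 0 := by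
  have hmeas : MeasurableSet (RZ.Cle (j + 1))ᶜ := (RZ.isClosed_Cle (j + 1)).measurableSet.compl
  rw [muLim, Measure.sum_apply _ hmeas, ENNReal.tsum_eq_zero]
  intro i
  rw [Measure.map_apply (RZ.measurable_comb i) hmeas]
  convert measure_empty (μ := Measure.pi fun _ : Fin (j + 1) => nuAlpha α)
  exact eq_empty_of_forall_notMem fun z hz => hz (RZ.comb_mem_Cle i z)

theorem theorem3p3
    {Ω : Type*} [MeasurableSpace Ω] (P : Measure Ω) [IsProbabilityMeasure P]
    -- i.i.d. nonnegative random variables with regularly varying tail of index `α`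
    (α : ℝ) (hα : 0 < α)
    (Z : ℤ → Ω → ℝ≥0) (hZ : ∀ i, Measurable (Z i))
    (hindep : iIndepFun Z P) (hident : ∀ i, IdentDistrib (Z i) (Z 0) P P)
    (b : ℝ → ℝ≥0) (hbpos : ∀ t, 0 < t → 0 < b t)
    (hb : ∀ z : ℝ, 0 < z →
      Tendsto (fun t : ℝ => t * P.real {ω | (b t : ℝ) * z < (Z 0 ω : ℝ)}) atTop (𝓝 (z ^ (-α))))
    -- the coefficients of the moving average
    (ψ : ℕ → ℝ≥0) (hψ : 0 < ψ 0) (m j : ℕ) :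
    -- the removed sets are closed cones and increase with `j`
    IsClosed (RZ.T ψ m '' RZ.Cle j) ∧
    (∀ c : ℝ≥0, 0 < c → ∀ x ∈ RZ.T ψ m '' RZ.Cle j, RZ.scale c x ∈ RZ.T ψ m '' RZ.Cle j) ∧
    RZ.T ψ m '' RZ.Cle j ⊆ RZ.T ψ m '' RZ.Cle (j + 1) ∧
    -- the scaling functions get finer as `j` increases
    Tendsto (fun t : ℝ => scaling b j t / scaling b (j + 1) t) atTop atTop ∧
    -- convergence
    ∃ (M : ℝ → MO (RZ.T ψ m '' RZ.Cle j)) (N : MO (RZ.T ψ m '' RZ.Cle j)),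
      (∀ t, 0 < t → (M t).toMeasure =
        restrictCompl (RZ.T ψ m '' RZ.Cle j) ((scaledLaw P b Z j t).map (RZ.T ψ m))) ∧
      (∀ t, 0 < t → (M t).toMeasure =
        restrictCompl (RZ.T ψ m '' RZ.Cle j) (scaledLaw P b (maProc ψ m Z) j t)) ∧
      N.toMeasure = restrictCompl (RZ.T ψ m '' RZ.Cle j) ((muLim α j).map (RZ.T ψ m)) ∧
      N.toMeasure = restrictCompl (RZ.T ψ m '' RZ.Cle j) (muLimMA α ψ m j) ∧
      Tendsto M atTop (𝓝 N) ∧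
      -- the limit is nonzero and concentrated on the next set of the family
      N.toMeasure ≠ 0 ∧
      N.toMeasure {x | (x : RZ) ∉ RZ.T ψ m '' RZ.Cle (j + 1)} = 0 := by
  set D := RZ.T ψ m '' RZ.Cle j with hDdef
  have hD : IsClosed D := RZ.isClosed_image_T hψ m (RZ.isClosed_Cle j)
  refine ⟨hD, ?_, image_mono (RZ.Cle_mono j.le_succ), ?_, ?_⟩
  · rintro c - x ⟨z, hz, rfl⟩
    exact ⟨RZ.scale c z, RZ.scale_mem_Cle hz c, RZ.T_scale ψ m c z⟩
  · refine tendsto_scaling_ratio hbpos hb (tendsto_time_root j) (tendsto_time_root (j + 1)) ?_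
    have hexp : 0 < 1 / ((j : ℝ) + 1) - 1 / (((j + 1 : ℕ) : ℝ) + 1) := by
      rw [sub_pos]
      push_cast
      exact one_div_lt_one_div_of_lt (by positivity) (by linarith)
    refine (tendsto_rpow_atTop hexp).congr' ?_
    filter_upwards [eventually_gt_atTop 0] with t ht
    exact Real.rpow_sub ht _ _
  have hsub : ∀ r : ℝ, 0 < r → ∃ (J : Finset ℤ) (ε : ℝ≥0), 0 < ε ∧
      ∀ z : RZ, RZ.T ψ m z ∉ Metric.thickening r D → z ∈ RZ.largeSet j J ε := fun r hr =>
    RZ.exists_mem_largeSet_of_notMem_thickening ψ m j hr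
  -- For `t ≤ 0` this is the zero measure, since `ENNReal.ofReal t = 0`; these values do not affect
  -- the limit.
  let M : ℝ → MO D := fun t => ⟨restrictCompl D ((scaledLaw P b Z j t).map (RZ.T ψ m)),
    fun r _ => by
      rw [restrictCompl_apply hD.measurableSet]
      exact measure_lt_top _ _⟩
  let N : MO D := ⟨restrictCompl D ((muLim α j).map (RZ.T ψ m)), fun r hr => by
    obtain ⟨J, ε, hε, hJ⟩ := hsub r hr
    rw [restrictCompl_apply hD.measurableSet]
    refine (measure_mono (t := (Metric.thickening r D)ᶜ) ?_).trans_lt ?_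
    · rintro _ ⟨x, hx, rfl⟩
      exact hx
    · rw [Measure.map_apply (RZ.measurable_T ψ m)
        Metric.isOpen_thickening.measurableSet.compl]
      exact (measure_mono fun z hz => hJ z hz).trans_lt (RZ.muLim_largeSet_lt_top hα j J hε)⟩
  have hNdef : N.toMeasure = restrictCompl D ((muLim α j).map (RZ.T ψ m)) := rfl
  refine ⟨M, N, fun t _ => rfl, fun t _ => ?_, rfl, ?_, ?_, ?_, ?_⟩
  · rw [← map_T_scaledLaw P b hZ]
    rfl
  · rw [← map_T_muLim]
    exact hNdef
  · refine MO.tendsto_iff.2 fun f => ?_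
    obtain ⟨F, r, hr, hF, hF0⟩ := f.exists_extension hD
    obtain ⟨J, ε, hε, hJ⟩ := hsub r hr
    have hFD : ∀ x ∈ D, F x = 0 := fun x hx => hF0 x (Metric.self_subset_thickening hr D hx)
    let g : RZ →ᵇ ℝ≥0 := F.compContinuous ⟨RZ.T ψ m, RZ.continuous_T ψ m⟩
    have hg : ∀ x ∉ RZ.largeSet j J ε, g x = 0 := fun x hx => by
      by_contra hne
      exact hx (hJ x fun hx' => hne (hF0 _ hx'))
    have hint : ∀ μ : Measure RZ,
        ∫ x, (f.1 x : ℝ) ∂(restrictCompl D (μ.map (RZ.T ψ m))) = (∫⁻ x, g x ∂μ).toReal :=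
      fun μ => by
        rw [integral_restrictCompl hD _ hF hFD,
          lintegral_map F.continuous.measurable.coe_nnreal_ennreal (RZ.measurable_T ψ m)]
        rfl
    have hbound : ∃ K : ℝ≥0, ∀ x, g x ≤ K :=
      ⟨_, BoundedContinuousFunction.NNReal.upper_bound g⟩
    obtain ⟨K, hK⟩ := hbound
    -- Finiteness of the limit is needed to pass from lower integrals in `ℝ≥0∞` to the real
    -- integrals defining the topology.
    have hfin : ∫⁻ x, g x ∂(muLim α j) ≠ ∞ := by
      have hle : ∫⁻ x, g x ∂(muLim α j) ≤
          ∫⁻ _ in RZ.largeSet j J ε, (K : ℝ≥0∞) ∂(muLim α j) := by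
        rw [← lintegral_indicator (RZ.isOpen_largeSet j J ε).measurableSet]
        refine lintegral_mono fun x => ?_
        by_cases hx : x ∈ RZ.largeSet j J ε
        · rw [indicator_of_mem hx]
          exact ENNReal.coe_le_coe.2 (hK x)
        · simp [hg x hx]
      refine ne_top_of_le_ne_top ?_ hle
      rw [setLIntegral_const]
      exact ENNReal.mul_ne_top ENNReal.coe_ne_top (RZ.muLim_largeSet_lt_top hα j J hε).ne
    have hlim := (ENNReal.tendsto_toReal hfin).comp
      (tendsto_lintegral_scaledLaw hα hZ hindep hident hbpos hb hε g hg)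
    rw [hNdef, hint]
    exact hlim.congr fun t => (hint _).symm
  · intro h0
    have h1 : N.toMeasure univ = 0 := by
      rw [h0]
      rfl
    rw [hNdef, restrictCompl_apply hD.measurableSet, image_univ, Subtype.range_coe,
      Measure.map_apply (RZ.measurable_T ψ m) hD.measurableSet.compl] at h1
    exact (muLim_apply_pos hα hψ m j).ne' h1
  · have hD' : IsClosed (RZ.T ψ m '' RZ.Cle (j + 1)) :=
      RZ.isClosed_image_T hψ m (RZ.isClosed_Cle (j + 1))
    rw [hNdef, restrictCompl_apply hD.measurableSet]
    refine measure_mono_null (t := (RZ.T ψ m '' RZ.Cle (j + 1))ᶜ) ?_ ?_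
    · rintro _ ⟨x, hx, rfl⟩
      exact hx
    · rw [Measure.map_apply (RZ.measurable_T ψ m) hD'.measurableSet.compl]
      exact measure_mono_null (fun z hz hz' => hz (mem_image_of_mem _ hz'))
        (muLim_apply_compl_Cle α j)
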